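/- Consider a $\sqrt n\times\sqrt n$ square grid graph with $n$ nodes, where $\sqrt n\ge 2$ is an integer. Nodes are anonymous and memoryless; at each node of degree $\delta$ the incident edges carry distinct port labels $1,\dots,\delta$ (the two labels of an edge are independent of each other). The grid is oriented: at each node of degree $4$, the ports of the edges to two opposite neighbours differ by $2$ modulo $4$. There are $n$ robots with distinct identifiers of $O(\log n)$ bits, placed arbitrarily on the nodes (several may share a node), and any $f\le n$ of them are weak Byzantine: they behave arbitrarily, but cannot falsify their identifiers. The robots work in synchronous rounds. In each round a robot perceives the degree of its node, the port by which it has just entered, and the identifiers and memory contents shown by the robots at the same node; it then updates its memory, and stays, leaves by a port, or terminates. All non-Byzantine robots show their true memory and run the same algorithm, and know in advance neither $n$ nor $f$. Then there is a deterministic algorithm (one for all $n$) such that, whatever the initial placement, the set of Byzantine robots and their behaviour, after $O(\sqrt n)$ rounds every non-Byzantine robot has terminated and every node holds at most one non-Byzantine robot; each non-Byzantine robot uses $O(n\log n)$ bits of memory. -/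

import Mathlib

namespace GridRobots

/-- The square grid with `s` rows and `s` columns, `n = s ^ 2` nodes. -/
abbrev grid (s : ℕ) : SimpleGraph (Fin s × Fin s) :=
  SimpleGraph.boxProd (SimpleGraph.pathGraph s) (SimpleGraph.pathGraph s)

/-- The degree of a node. -/
noncomputable def deg {V : Type} (G : SimpleGraph V) (v : V) : ℕ := (G.neighborSet v).ncard

/-- A port labelling: at every node `v` the incident edges carry the distinct labels
`1, …, deg v`. `port v w` is the label at `v` of the edge from `v` to `w`. The two labels of one
edge are independent of each other. -/
structure PortLabeling {V : Type} (G : SimpleGraph V) where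
  port : V → V → ℕ
  bijOn : ∀ v, Set.BijOn (port v) (G.neighborSet v) (Set.Icc 1 (deg G v))

/-- An oriented grid: at every internal node (degree 4), a robot that has entered by a port goes
straight on by skipping one port and taking the next one (cyclically modulo 4), that is, edges to
opposite neighbours `a`, `b` of `v` (two distinct neighbours in one row or one column) have labels
that differ by 2 modulo 4. Nothing is assumed at nodes of degree 2 or 3. -/
def PortLabeling.Oriented {s : ℕ} (L : PortLabeling (grid s)) : Prop :=
  ∀ v a b : Fin s × Fin s, deg (grid s) v = 4 → (grid s).Adj v a → (grid s).Adj v b → a ≠ b →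
    (a.1 = b.1 ∨ a.2 = b.2) → L.port v a ≡ L.port v b + 2 [MOD 4]

/-- What a robot decides to do at the end of a round. -/
inductive Action where
  | stay
  | move (p : ℕ)
  | halt

/-- What a robot perceives in a round: the degree of its node, the port by which it has entered
the node if it has just moved, and the identifiers of the other robots at the node, each with the
memory content that this robot shows. -/
structure Observation where
  degree : ℕ
  entryPort : Option ℕ
  others : Finset (ℕ × List Bool)

/-- A deterministic algorithm. From its own identifier, its own memory (a bit string) and its
observation, a robot computes its new memory and its action. All robots run the same algorithm;
the size of the grid, the number of robots and the number of faulty ones are not part of the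
input. -/
abbrev Algorithm := ℕ → List Bool → Observation → List Bool × Action

/-- The state of one robot. -/
structure RobotState (V : Type) where
  pos : V
  entryPort : Option ℕ
  memory : List Bool
  halted : Bool

open Classical in
/-- The state of a robot after a round in which it has computed the memory content `m` and the
action `a`. Leaving by a port that does not exist has no effect. -/
noncomputable def RobotState.apply {V : Type} {G : SimpleGraph V} (L : PortLabeling G)
    (q : RobotState V) (m : List Bool) (a : Action) : RobotState V :=
  match a with
  | .stay => ⟨q.pos, none, m, false⟩
  | .halt => ⟨q.pos, none, m, true⟩
  | .move p =>
    if h : ∃ w, G.Adj q.pos w ∧ L.port q.pos w = p then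
      ⟨h.choose, some (L.port h.choose q.pos), m, false⟩
    else ⟨q.pos, none, m, false⟩

/-- A history of a system of robots `R` on `V`: in every round `t`, the state of every robot,
whether robot `j` can be perceived (`present t j`), and the memory content that robot `j` shows to
the robot `i` (`shown t i j`). -/
structure History (V R : Type) where
  state : ℕ → R → RobotState V
  present : ℕ → R → Prop
  shown : ℕ → R → R → List Bool

open Classical in
/-- The observation of robot `i` in round `t`. Identifiers are always perceived correctly, and in
the same way by all robots at the node. -/
noncomputable def History.observe {V R : Type} [Fintype R] (E : History V R) (G : SimpleGraph V)
    (ident : R → ℕ) (t : ℕ) (i : R) : Observation where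
  degree := deg G (E.state t i).pos
  entryPort := (E.state t i).entryPort
  others := (Finset.univ.filter fun j =>
      j ≠ i ∧ E.present t j ∧ (E.state t j).pos = (E.state t i).pos).image
    fun j => (ident j, E.shown t i j)

/-- `E` is an execution of the algorithm `A` in which exactly the robots of `B` are weak
Byzantine.

Initial positions are arbitrary. A non-Byzantine robot starts with empty memory, can always be
perceived, shows its true memory, and runs `A` in synchronous rounds until it halts; then it stays
as it is.

The only constraint on a Byzantine robot is that it stays at its node or traverses one edge per
round. In every round it may show any memory content, different ones to different robots, and it
may also be imperceptible (as after a crash), but when it is perceived, it is perceived under its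
own identifier. -/
structure History.IsExecution {V R : Type} [Fintype R] {G : SimpleGraph V} (E : History V R)
    (A : Algorithm) (L : PortLabeling G) (ident : R → ℕ) (B : Finset R) : Prop where
  start : ∀ i, i ∉ B → (E.state 0 i).entryPort = none ∧ (E.state 0 i).memory = [] ∧
    (E.state 0 i).halted = false
  present : ∀ t i, i ∉ B → E.present t i
  shown : ∀ t i j, j ∉ B → E.shown t i j = (E.state t j).memory
  step : ∀ t i, i ∉ B → (E.state t i).halted = false →
    E.state (t + 1) i = (E.state t i).apply L
      (A (ident i) (E.state t i).memory (E.observe G ident t i)).1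
      (A (ident i) (E.state t i).memory (E.observe G ident t i)).2
  frozen : ∀ t i, i ∉ B → (E.state t i).halted = true → E.state (t + 1) i = E.state t i
  byzantine : ∀ t i, i ∈ B → (E.state (t + 1) i).pos = (E.state t i).pos ∨
    G.Adj (E.state t i).pos (E.state (t + 1) i).pos

/-- All non-Byzantine robots have terminated, and no node holds two of them. -/
def Dispersed {V R : Type} (B : Finset R) (q : R → RobotState V) : Prop :=
  (∀ i, i ∉ B → (q i).halted = true) ∧
    ∀ i j, i ∉ B → j ∉ B → i ≠ j → (q i).pos ≠ (q j).pos

end GridRobots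

/-! The robots are synchronized by macro rounds of four rounds each. A robot never reads a displayed
memory: it uses only degrees, entry ports and the identifiers present at its node. Identifiers
cannot be forged and all robots at a node perceive the same ones (`insert_others`), so honest robots
that stay together with equal data keep equal data.

Orientation lets a robot go straight on in the interior. On the boundary, degrees tell the inward
edge from the others, at the cost of one probe. Hence a robot reaches a side, then a corner,
measures the side up to the next corner, and waits until macro round `3 * s` (`ready_program`). For
odd `s` all robots then pass through the centre and leave it with the same stored port, so they meet
at one corner (`ready_dispersion`), which owns `s ^ 2` slots. For even `s` each corner owns the `(s
/ 2) ^ 2` slots of its quadrant.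

The robots at a corner list the identifiers present. The identifier of rank `r` takes the `r`-th
slot, and those left over form a group that walks to the next three corners. Groups that meet at a
corner have come by different ports and choose one after the other. Before a choice, the settled
robots announce row and column by being absent at the corresponding tick. The group ignores
identifiers it already knows, and only the first absence counts, so each new identifier, Byzantine
or not, blocks at most one slot.

The invariants are collected in `Arrangement`; `Arrangement.choose` carries the main argument.
Suppose that a choice leaves a robot without a slot. If `a` slots were free and `b` new identifiers
were heard, then `h ^ 2 ≤ a + b`; the group loses `a` identifiers and the known set gains `b`. So
each choice raises the difference between known and group identifiers by at least `h ^ 2`. After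
four corners it would be at least `4 * h ^ 2 ≥ s ^ 2`, with the group still nonempty, contradicting
the number of robots (`Arrangement.slot_ne_none`). Ignoring known identifiers is safe: a known
settled honest robot sits at a corner visited earlier.

Finally each robot walks to its slot (`ready_approach`), and `dispersed` compares the end positions.
The memory holds `O(√n)` instructions, three sets of identifiers and two tables with one entry per
identifier at most (`length_memory_le`). -/

namespace GridRobots

/-! ### Self-delimiting codes -/

/-- A code whose words can be read off the front of any bit string that starts with them. -/
def IsPrefixCode {α : Type} (f : α → List Bool) : Prop :=
  ∀ a b u v, f a ++ u = f b ++ v → a = b ∧ u = v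

theorem IsPrefixCode.injective {α : Type} {f : α → List Bool} (hf : IsPrefixCode f) :
    Function.Injective f := fun a b h => (hf a b [] [] (by simpa using h)).1

def boolCode (b : Bool) : List Bool := [b]

theorem isPrefixCode_boolCode : IsPrefixCode boolCode := by
  intro a b u v h
  simpa [boolCode] using h

/-- The flag before each entry makes the list self-delimiting for one extra bit per entry and one at
the end. -/
def listCode {α : Type} (f : α → List Bool) : List α → List Bool
  | [] => [false]
  | a :: l => true :: (f a ++ listCode f l)

theorem IsPrefixCode.list {α : Type} {f : α → List Bool} (hf : IsPrefixCode f) :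
    IsPrefixCode (listCode f) := by
  intro a
  induction a with
  | nil =>
    intro b u v h
    cases b with
    | nil => simpa [listCode] using h
    | cons c l => simp [listCode] at h
  | cons c l ih =>
    intro b u v h
    cases b with
    | nil => simp [listCode] at h
    | cons c' l' =>
      simp only [listCode, List.cons_append, List.cons.injEq, true_and, List.append_assoc] at h
      obtain ⟨rfl, h'⟩ := hf _ _ _ _ h
      obtain ⟨rfl, h''⟩ := ih _ _ _ h'
      exact ⟨rfl, h''⟩

theorem length_listCode_le {α : Type} {f : α → List Bool} {l : List α} {K : ℕ}
    (h : ∀ a ∈ l, (f a).length ≤ K) : (listCode f l).length ≤ l.length * (K + 1) + 1 := by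
  induction l with
  | nil => simp [listCode]
  | cons a l ih =>
    have h1 := ih fun b hb => h b (List.mem_cons_of_mem _ hb)
    have h2 := h a List.mem_cons_self
    simp only [listCode, List.length_cons, List.length_append]
    nlinarith

def pairCode {α β : Type} (f : α → List Bool) (g : β → List Bool) (p : α × β) : List Bool :=
  f p.1 ++ g p.2

theorem IsPrefixCode.pair {α β : Type} {f : α → List Bool} {g : β → List Bool}
    (hf : IsPrefixCode f) (hg : IsPrefixCode g) : IsPrefixCode (pairCode f g) := by
  rintro ⟨a, b⟩ ⟨a', b'⟩ u v h
  simp only [pairCode, List.append_assoc] at h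
  obtain ⟨rfl, h'⟩ := hf _ _ _ _ h
  obtain ⟨rfl, h''⟩ := hg _ _ _ _ h'
  exact ⟨rfl, h''⟩

theorem IsPrefixCode.comp {α β : Type} {f : α → List Bool} (hf : IsPrefixCode f) {g : β → α}
    (hg : Function.Injective g) : IsPrefixCode (f ∘ g) := by
  intro a b u v h
  obtain ⟨h1, h2⟩ := hf _ _ _ _ h
  exact ⟨hg h1, h2⟩

def natCode : ℕ → List Bool := listCode boolCode ∘ Nat.bits

theorem bits_injective : Function.Injective Nat.bits := by
  intro a
  induction a using Nat.binaryRec' with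
  | zero =>
    intro b h
    have := congrArg List.length h
    rw [Nat.size_eq_bits_len, Nat.size_eq_bits_len, Nat.size_zero] at this
    exact (Nat.size_eq_zero.1 this.symm).symm
  | bit b n hn ih =>
    intro m
    induction m using Nat.binaryRec' with
    | zero =>
      intro h
      have := congrArg List.length h
      rw [Nat.size_eq_bits_len, Nat.size_eq_bits_len, Nat.size_zero] at this
      exact Nat.size_eq_zero.1 this
    | bit c m hm _ =>
      intro h
      rw [Nat.bits_append_bit _ _ hn, Nat.bits_append_bit _ _ hm] at h
      simp only [List.cons.injEq] at h
      rw [h.1, ih h.2]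

theorem isPrefixCode_natCode : IsPrefixCode natCode :=
  isPrefixCode_boolCode.list.comp bits_injective

theorem length_natCode_le (n : ℕ) : (natCode n).length ≤ 2 * n.size + 1 := by
  have := length_listCode_le (f := boolCode) (l := n.bits) (K := 1) (by simp [boolCode])
  rw [Nat.size_eq_bits_len] at this
  simp only [natCode, Function.comp_apply]
  omega

noncomputable def finsetCode {α : Type} (f : α → List Bool) : Finset α → List Bool :=
  listCode f ∘ Finset.toList

theorem IsPrefixCode.finset {α : Type} {f : α → List Bool} (hf : IsPrefixCode f) :
    IsPrefixCode (finsetCode f) := by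
  classical
  refine hf.list.comp fun a b h => ?_
  have := congrArg List.toFinset h
  simpa using this

theorem length_finsetCode_le {α : Type} {f : α → List Bool} {s : Finset α} {K : ℕ}
    (h : ∀ a ∈ s, (f a).length ≤ K) : (finsetCode f s).length ≤ s.card * (K + 1) + 1 := by
  have := length_listCode_le (f := f) (l := s.toList) (K := K) (by simpa using h)
  simpa [finsetCode] using this

/-! ### Coordinates on the grid -/

/-- One of the eight coordinate systems of the square. -/
structure Frame where
  swap : Bool
  flipX : Bool
  flipY : Bool

namespace Frame

/-- The frame at the far end of the first axis of `F`, with its second axis pointing back along that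
side. A walk along the first axis thus arrives at the new origin along the second axis, ready to
repeat. -/
def rot (F : Frame) : Frame :=
  if F.swap then ⟨false, F.flipX, !F.flipY⟩ else ⟨true, !F.flipX, F.flipY⟩

/-- Reverses the first axis only, so that a walk towards smaller coordinates becomes one towards
larger coordinates on the same side. -/
def mirror (F : Frame) : Frame :=
  if F.swap then ⟨true, F.flipX, !F.flipY⟩ else ⟨false, !F.flipX, F.flipY⟩

def transpose (F : Frame) : Frame := ⟨!F.swap, F.flipX, F.flipY⟩

end Frame

def reflect (s : ℕ) (b : Bool) (i : ℕ) : ℕ := if b then s - 1 - i else i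

/-- The node with coordinates `(i, j)` in the frame `F`. -/
def pt (s : ℕ) [NeZero s] (F : Frame) (i j : ℕ) : Fin s × Fin s :=
  (Fin.ofNat s (reflect s F.flipX (if F.swap then j else i)),
    Fin.ofNat s (reflect s F.flipY (if F.swap then i else j)))

theorem reflect_lt {s : ℕ} {b : Bool} {i : ℕ} (hi : i < s) : reflect s b i < s := by
  unfold reflect; split <;> omega

theorem grid_adj_iff {s : ℕ} {u v : Fin s × Fin s} : (grid s).Adj u v ↔
    ((u.1 : ℕ) + 1 = v.1 ∨ (v.1 : ℕ) + 1 = u.1) ∧ (u.2 : ℕ) = v.2 ∨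
      ((u.2 : ℕ) + 1 = v.2 ∨ (v.2 : ℕ) + 1 = u.2) ∧ (u.1 : ℕ) = v.1 := by
  rw [SimpleGraph.boxProd_adj, SimpleGraph.pathGraph_adj, SimpleGraph.pathGraph_adj,
    Fin.ext_iff, Fin.ext_iff]

section Coordinates

variable {s : ℕ} [NeZero s]

theorem pt_fst_val (F : Frame) {i j : ℕ} (hi : i < s) (hj : j < s) :
    ((pt s F i j).1 : ℕ) = reflect s F.flipX (if F.swap then j else i) := by
  simp only [pt, Fin.val_ofNat]
  exact Nat.mod_eq_of_lt (reflect_lt (by split <;> assumption))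

theorem pt_snd_val (F : Frame) {i j : ℕ} (hi : i < s) (hj : j < s) :
    ((pt s F i j).2 : ℕ) = reflect s F.flipY (if F.swap then i else j) := by
  simp only [pt, Fin.val_ofNat]
  exact Nat.mod_eq_of_lt (reflect_lt (by split <;> assumption))

theorem eq_pt_iff (F : Frame) (v : Fin s × Fin s) {i j : ℕ} (hi : i < s) (hj : j < s) :
    v = pt s F i j ↔ (v.1 : ℕ) = reflect s F.flipX (if F.swap then j else i) ∧
      (v.2 : ℕ) = reflect s F.flipY (if F.swap then i else j) := by
  rw [Prod.ext_iff, Fin.ext_iff, Fin.ext_iff, pt_fst_val F hi hj, pt_snd_val F hi hj]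

theorem pt_inj {F : Frame} {i j i' j' : ℕ} (hi : i < s) (hj : j < s) (hi' : i' < s)
    (hj' : j' < s) (h : pt s F i j = pt s F i' j') : i = i' ∧ j = j' := by
  rw [eq_pt_iff F _ hi' hj', pt_fst_val F hi hj, pt_snd_val F hi hj] at h
  obtain ⟨_ | _, _ | _, _ | _⟩ := F <;> simp [reflect] at h <;> omega

theorem exists_eq_pt (F : Frame) (v : Fin s × Fin s) :
    ∃ i j, i < s ∧ j < s ∧ v = pt s F i j := by
  obtain ⟨a, b⟩ := v
  have ha := a.2
  have hb := b.2
  have aux : ∀ c : Bool, ∀ x < s, reflect s c (reflect s c x) = x := by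
    intro c x hx; cases c <;> simp [reflect]; omega
  by_cases h : F.swap = true
  · refine ⟨reflect s F.flipY b, reflect s F.flipX a, reflect_lt hb, reflect_lt ha, ?_⟩
    rw [eq_pt_iff F _ (reflect_lt hb) (reflect_lt ha)]
    simp [h, aux _ _ ha, aux _ _ hb]
  · refine ⟨reflect s F.flipX a, reflect s F.flipY b, reflect_lt ha, reflect_lt hb, ?_⟩
    rw [eq_pt_iff F _ (reflect_lt ha) (reflect_lt hb)]
    simp [h, aux _ _ ha, aux _ _ hb]

theorem pt_adj_iff (F : Frame) {i j i' j' : ℕ} (hi : i < s) (hj : j < s) (hi' : i' < s)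
    (hj' : j' < s) : (grid s).Adj (pt s F i j) (pt s F i' j') ↔
      (i + 1 = i' ∨ i' + 1 = i) ∧ j = j' ∨ (j + 1 = j' ∨ j' + 1 = j) ∧ i = i' := by
  rw [grid_adj_iff, pt_fst_val F hi hj, pt_snd_val F hi hj, pt_fst_val F hi' hj',
    pt_snd_val F hi' hj']
  obtain ⟨_ | _, _ | _, _ | _⟩ := F <;> simp [reflect] <;> omega

theorem eq_of_adj_pt {F : Frame} {i j : ℕ} (hi : i < s) (hj : j < s) {w : Fin s × Fin s}
    (h : (grid s).Adj (pt s F i j) w) :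
    (i + 1 < s ∧ w = pt s F (i + 1) j) ∨ (0 < i ∧ w = pt s F (i - 1) j) ∨
      (j + 1 < s ∧ w = pt s F i (j + 1)) ∨ (0 < j ∧ w = pt s F i (j - 1)) := by
  obtain ⟨i', j', hi', hj', rfl⟩ := exists_eq_pt F w
  rw [pt_adj_iff F hi hj hi' hj'] at h
  rcases h with ⟨rfl | rfl, rfl⟩ | ⟨rfl | rfl, rfl⟩ <;> simp [*]

theorem pt_rot (F : Frame) {i j : ℕ} (hi : i < s) (hj : j < s) :
    pt s F.rot i j = pt s F (s - 1 - j) i := by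
  rw [eq_pt_iff F _ (by omega) hi, pt_fst_val _ hi hj, pt_snd_val _ hi hj]
  obtain ⟨_ | _, _ | _, _ | _⟩ := F <;> simp [reflect, Frame.rot] <;> omega

theorem pt_mirror (F : Frame) {i j : ℕ} (hi : i < s) (hj : j < s) :
    pt s F.mirror i j = pt s F (s - 1 - i) j := by
  rw [eq_pt_iff F _ (by omega) hj, pt_fst_val _ hi hj, pt_snd_val _ hi hj]
  obtain ⟨_ | _, _ | _, _ | _⟩ := F <;> simp [reflect, Frame.mirror] <;> omega

theorem pt_transpose (F : Frame) (i j : ℕ) : pt s F.transpose i j = pt s F j i := by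
  obtain ⟨_ | _, _ | _, _ | _⟩ := F <;> simp [pt, Frame.transpose]

/-- A symmetry of the square is determined by a corner and one of the two sides there. -/
theorem frame_ext (hs : 2 ≤ s) {F F' : Frame} (h0 : pt s F 0 0 = pt s F' 0 0)
    (h1 : pt s F 0 1 = pt s F' 0 1) : F = F' := by
  rw [eq_pt_iff _ _ (by omega) (by omega), pt_fst_val _ (by omega) (by omega),
    pt_snd_val _ (by omega) (by omega)] at h0 h1
  obtain ⟨_ | _, _ | _, _ | _⟩ := F <;> obtain ⟨_ | _, _ | _, _ | _⟩ := F' <;>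
    simp [reflect] at h0 h1 ⊢ <;> omega

/-- The number of neighbours on a line. -/
def lineDeg (s i : ℕ) : ℕ := (if 0 < i then 1 else 0) + (if i + 1 < s then 1 else 0)

theorem deg_pt (F : Frame) {i j : ℕ} (hi : i < s) (hj : j < s) :
    deg (grid s) (pt s F i j) = lineDeg s i + lineDeg s j := by
  classical
  have key : (grid s).neighborSet (pt s F i j) =
      (((if 0 < i then {pt s F (i - 1) j} else ∅) ∪ (if i + 1 < s then {pt s F (i + 1) j} else ∅)) ∪
        ((if 0 < j then {pt s F i (j - 1)} else ∅) ∪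
          (if j + 1 < s then {pt s F i (j + 1)} else ∅)) : Finset (Fin s × Fin s)) := by
    ext w
    constructor
    · intro h
      rcases eq_of_adj_pt hi hj h with ⟨h', rfl⟩ | ⟨h', rfl⟩ | ⟨h', rfl⟩ | ⟨h', rfl⟩ <;>
        simp [h']
    · intro h
      rw [SimpleGraph.mem_neighborSet]
      simp only [Finset.coe_union, Set.mem_union, Finset.mem_coe] at h
      rcases h with (h | h) | (h | h) <;> split at h <;> simp at h <;> subst h <;>
        rw [pt_adj_iff F hi hj (by omega) (by omega)] <;> omega
  rw [deg, key, Set.ncard_coe_finset]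
  have hne : ∀ {a b c d : ℕ}, a < s → b < s → c < s → d < s → ¬ (a = c ∧ b = d) →
      pt s F a b ≠ pt s F c d := fun ha hb hc hd h e => h (pt_inj ha hb hc hd e)
  rw [Finset.card_union_of_disjoint, Finset.card_union_of_disjoint, Finset.card_union_of_disjoint]
  · unfold lineDeg
    split <;> split <;> split <;> split <;> simp
  · rw [Finset.disjoint_left]
    intro w hw hw'
    split at hw <;> split at hw' <;> simp at hw hw'
    exact hne (by omega) (by omega) (by omega) (by omega) (by omega) (hw.symm.trans hw')
  · rw [Finset.disjoint_left]
    intro w hw hw'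
    split at hw <;> split at hw' <;> simp at hw hw'
    exact hne (by omega) (by omega) (by omega) (by omega) (by omega) (hw.symm.trans hw')
  · rw [Finset.disjoint_left]
    intro w hw hw'
    simp only [Finset.mem_union] at hw hw'
    rcases hw with hw | hw <;> rcases hw' with hw' | hw' <;>
      split at hw <;> split at hw' <;> simp at hw hw' <;>
      exact hne (by omega) (by omega) (by omega) (by omega) (by omega) (hw.symm.trans hw')

theorem deg_le_four (v : Fin s × Fin s) : deg (grid s) v ≤ 4 := by
  obtain ⟨i, j, hi, hj, rfl⟩ := exists_eq_pt ⟨false, false, false⟩ v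
  rw [deg_pt _ hi hj]
  unfold lineDeg
  split <;> split <;> split <;> split <;> omega

theorem deg_corner (hs : 2 ≤ s) (F : Frame) : deg (grid s) (pt s F 0 0) = 2 := by
  rw [deg_pt F (by omega) (by omega), lineDeg]
  simp only [Nat.lt_irrefl, if_false]
  rw [if_pos (by omega)]

theorem deg_side (hs : 2 ≤ s) (F : Frame) {i : ℕ} (hi : 0 < i) (hi' : i + 1 < s) :
    deg (grid s) (pt s F i 0) = 3 := by
  rw [deg_pt F (by omega) (by omega), lineDeg, lineDeg, if_pos hi, if_pos hi', if_neg (by omega),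
    if_pos (by omega)]

theorem deg_inner (F : Frame) {i j : ℕ} (hi : 0 < i) (hi' : i + 1 < s) (hj : 0 < j)
    (hj' : j + 1 < s) : deg (grid s) (pt s F i j) = 4 := by
  rw [deg_pt F (by omega) (by omega), lineDeg, lineDeg, if_pos hi, if_pos hi', if_pos hj,
    if_pos hj']

theorem two_le_deg (hs : 2 ≤ s) (v : Fin s × Fin s) : 2 ≤ deg (grid s) v := by
  obtain ⟨i, j, hi, hj, rfl⟩ := exists_eq_pt ⟨false, false, false⟩ v
  rw [deg_pt _ hi hj]
  unfold lineDeg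
  split <;> split <;> split <;> split <;> omega

/-- In a suitable frame, a node has coordinates in the lower left triangle. -/
theorem exists_frame_of_deg_two (hs : 2 ≤ s) {v : Fin s × Fin s} (h : deg (grid s) v = 2) :
    ∃ F, v = pt s F 0 0 := by
  obtain ⟨i, j, hi, hj, rfl⟩ := exists_eq_pt ⟨false, false, false⟩ v
  rw [deg_pt _ hi hj] at h
  have h1 : i = 0 ∨ i = s - 1 := by
    unfold lineDeg at h; split at h <;> split at h <;> split at h <;> split at h <;> omega
  have h2 : j = 0 ∨ j = s - 1 := by
    unfold lineDeg at h; split at h <;> split at h <;> split at h <;> split at h <;> omega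
  refine ⟨⟨false, decide (i ≠ 0), decide (j ≠ 0)⟩, ?_⟩
  rw [eq_pt_iff _ _ (by omega) (by omega), pt_fst_val _ hi hj, pt_snd_val _ hi hj]
  rcases h1 with rfl | rfl <;> rcases h2 with rfl | rfl <;> simp [reflect]

theorem exists_frame_of_deg_three (hs : 2 ≤ s) {v : Fin s × Fin s} (h : deg (grid s) v = 3) :
    ∃ F i, 0 < i ∧ i + 1 < s ∧ v = pt s F i 0 := by
  obtain ⟨i, j, hi, hj, rfl⟩ := exists_eq_pt ⟨false, false, false⟩ v
  rw [deg_pt _ hi hj] at h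
  have h1 : (0 < i ∧ i + 1 < s ∧ (j = 0 ∨ j = s - 1)) ∨
      (0 < j ∧ j + 1 < s ∧ (i = 0 ∨ i = s - 1)) := by
    unfold lineDeg at h; split at h <;> split at h <;> split at h <;> split at h <;> omega
  rcases h1 with ⟨h1, h2, h3⟩ | ⟨h1, h2, h3⟩
  · refine ⟨⟨false, false, decide (j ≠ 0)⟩, i, h1, h2, ?_⟩
    rw [eq_pt_iff _ _ (by omega) (by omega), pt_fst_val _ hi hj, pt_snd_val _ hi hj]
    rcases h3 with rfl | rfl <;> simp [reflect]
  · refine ⟨⟨true, decide (i ≠ 0), false⟩, j, h1, h2, ?_⟩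
    rw [eq_pt_iff _ _ (by omega) (by omega), pt_fst_val _ hi hj, pt_snd_val _ hi hj]
    rcases h3 with rfl | rfl <;> simp [reflect]

/-- Choosing the frame so that the given direction is the second axis reduces all four directions to
one computation. -/
theorem exists_frame_of_deg_four {v w : Fin s × Fin s} (h : deg (grid s) v = 4)
    (hw : (grid s).Adj v w) : ∃ F i j, 0 < i ∧ i + 1 < s ∧ 0 < j ∧ j + 1 < s ∧
      v = pt s F i j ∧ w = pt s F i (j + 1) := by
  obtain ⟨i, j, hi, hj, rfl⟩ := exists_eq_pt ⟨false, false, false⟩ v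
  rw [deg_pt _ hi hj] at h
  have h1 : 0 < i ∧ i + 1 < s ∧ 0 < j ∧ j + 1 < s := by
    unfold lineDeg at h; split at h <;> split at h <;> split at h <;> split at h <;> omega
  obtain ⟨h1, h2, h3, h4⟩ := h1
  rcases eq_of_adj_pt hi hj hw with ⟨-, rfl⟩ | ⟨-, rfl⟩ | ⟨-, rfl⟩ | ⟨-, rfl⟩
  · refine ⟨⟨true, false, false⟩, j, i, h3, h4, h1, h2, ?_, ?_⟩ <;>
      rw [eq_pt_iff _ _ (by omega) (by omega), pt_fst_val _ (by omega) (by omega),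
        pt_snd_val _ (by omega) (by omega)] <;> simp [reflect]
  · refine ⟨⟨true, true, false⟩, j, s - 1 - i, h3, h4, by omega, by omega, ?_, ?_⟩ <;>
      rw [eq_pt_iff _ _ (by omega) (by omega), pt_fst_val _ (by omega) (by omega),
        pt_snd_val _ (by omega) (by omega)] <;> simp [reflect] <;> omega
  · exact ⟨⟨false, false, false⟩, i, j, h1, h2, h3, h4, rfl, rfl⟩
  · refine ⟨⟨false, false, true⟩, i, s - 1 - j, h1, h2, by omega, by omega, ?_, ?_⟩ <;>
      rw [eq_pt_iff _ _ (by omega) (by omega), pt_fst_val _ (by omega) (by omega),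
        pt_snd_val _ (by omega) (by omega)] <;> simp [reflect] <;> omega

end Coordinates

/-! ### Walking straight on with arbitrary port labels -/

section Ports

variable {V : Type} {G : SimpleGraph V} (L : PortLabeling G)

theorem PortLabeling.port_mem {v w : V} (h : G.Adj v w) :
    1 ≤ L.port v w ∧ L.port v w ≤ deg G v := (L.bijOn v).mapsTo h

theorem PortLabeling.port_inj {v w w' : V} (h : G.Adj v w) (h' : G.Adj v w')
    (e : L.port v w = L.port v w') : w = w' := (L.bijOn v).injOn h h' e

theorem PortLabeling.exists_port {v : V} {p : ℕ} (h : 1 ≤ p) (h' : p ≤ deg G v) :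
    ∃ w, G.Adj v w ∧ L.port v w = p := by
  obtain ⟨w, hw, e⟩ := (L.bijOn v).surjOn (Set.mem_Icc.2 ⟨h, h'⟩)
  exact ⟨w, hw, e⟩

open Classical in
/-- The node reached from `v` by port `p`. -/
noncomputable def PortLabeling.next (v : V) (p : ℕ) : V :=
  if h : ∃ w, G.Adj v w ∧ L.port v w = p then h.choose else v

theorem PortLabeling.next_port {v w : V} (h : G.Adj v w) : L.next v (L.port v w) = w := by
  have h' : ∃ u, G.Adj v u ∧ L.port v u = L.port v w := ⟨w, h, rfl⟩
  rw [PortLabeling.next, dif_pos h']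
  exact L.port_inj h'.choose_spec.1 h h'.choose_spec.2

theorem PortLabeling.adj_next {v : V} {p : ℕ} (h : 1 ≤ p) (h' : p ≤ deg G v) :
    G.Adj v (L.next v p) := by
  have h := L.exists_port h h'
  rw [PortLabeling.next, dif_pos h]
  exact h.choose_spec.1

theorem PortLabeling.port_next {v : V} {p : ℕ} (h : 1 ≤ p) (h' : p ≤ deg G v) :
    L.port v (L.next v p) = p := by
  have h := L.exists_port h h'
  rw [PortLabeling.next, dif_pos h]
  exact h.choose_spec.2

open Classical in
/-- Try the port `p` first. If the node reached has degree 4 where this is not wanted, or does not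
have degree 4 where this is wanted, go back and take the port `p'`. -/
noncomputable def PortLabeling.probe (v : V) (p p' : ℕ) (inward : Bool) : V :=
  if (deg G (L.next v p) = 4 ↔ inward = true) then L.next v p else L.next v p'

end Ports

/-- The first port to try at a node of degree `d` in order not to go back by port `b`. -/
def firstPort (d b : ℕ) : ℕ :=
  if d = 4 then (if b ≤ 2 then b + 2 else b - 2) else if b = 1 then 2 else 1

/-- The second port to try. -/
def secondPort (d b : ℕ) : ℕ :=
  if d = 3 then (if b = 3 then 2 else 3) else firstPort d b

theorem firstPort_bounds {d b : ℕ} (hd : 2 ≤ d) (hb : 1 ≤ b) (hb' : b ≤ 4) :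
    1 ≤ firstPort d b ∧ firstPort d b ≤ d := by
  unfold firstPort; split <;> split <;> omega

theorem secondPort_bounds {d b : ℕ} (hd : 2 ≤ d) (hb : 1 ≤ b) (hb' : b ≤ 4) :
    1 ≤ secondPort d b ∧ secondPort d b ≤ d := by
  unfold secondPort
  split
  · split <;> omega
  · exact firstPort_bounds hd hb hb'

/-- One step of a walk from `x.1`, where `x.2` is the port that leads back. With `inward = false`
the walk goes straight on, with `inward = true` it turns from the boundary into the interior. -/
noncomputable def PortLabeling.step {V : Type} {G : SimpleGraph V} (L : PortLabeling G)
    (inward : Bool) (x : V × ℕ) : V × ℕ :=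
  (L.probe x.1 (firstPort (deg G x.1) x.2) (secondPort (deg G x.1) x.2) inward,
    L.port (L.probe x.1 (firstPort (deg G x.1) x.2) (secondPort (deg G x.1) x.2) inward) x.1)

/-- The node `w`, with the port that leads to `v`. -/
def PortLabeling.arrive {V : Type} {G : SimpleGraph V} (L : PortLabeling G) (w v : V) : V × ℕ :=
  (w, L.port w v)

theorem step_eq_of_probe {s : ℕ} {L : PortLabeling (grid s)} {b : ℕ} {v w : Fin s × Fin s}
    {c : Bool}
    (h : L.probe v (firstPort (deg (grid s) v) b) (secondPort (deg (grid s) v) b) c = w) :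
    L.step c (v, b) = L.arrive w v := by
  simp only [PortLabeling.step, PortLabeling.arrive, h]

/-- At degree 4 both candidate ports coincide, so the probe has no influence. Orientation is not
needed here: the first step may go in any direction. -/
theorem exists_step_inner {s : ℕ} {L : PortLabeling (grid s)} {v : Fin s × Fin s}
    (hv : deg (grid s) v = 4) {b : ℕ}
    (hb : 1 ≤ b) (hb' : b ≤ 4) : (grid s).Adj v (L.next v (firstPort 4 b)) ∧
      L.step false (v, b) = L.arrive (L.next v (firstPort 4 b)) v := by
  have h := firstPort_bounds (d := 4) (by omega) hb hb'
  refine ⟨L.adj_next h.1 (by rw [hv]; exact h.2), ?_⟩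
  apply step_eq_of_probe
  have e : secondPort 4 b = firstPort 4 b := by simp [secondPort]
  rw [hv, e, PortLabeling.probe, ite_self]

section Grid

variable {s : ℕ} [NeZero s] {L : PortLabeling (grid s)}

/-- At degree 2 both candidate ports are port 2 if `b = 1` and port 1 otherwise, so the outcome of
the probe is irrelevant. -/
theorem step_corner_of_port (hs : 2 ≤ s) {F : Frame} {b : ℕ} (c : Bool)
    (h : L.port (pt s F 0 0) (pt s F 1 0) = if b = 1 then 2 else 1) :
    L.step c (pt s F 0 0, b) = L.arrive (pt s F 1 0) (pt s F 0 0) := by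
  apply step_eq_of_probe
  rw [deg_corner hs]
  have h1 : firstPort 2 b = L.port (pt s F 0 0) (pt s F 1 0) := by rw [h]; simp [firstPort]
  have h2 : secondPort 2 b = L.port (pt s F 0 0) (pt s F 1 0) := by rw [← h1]; simp [secondPort]
  have hadj : (grid s).Adj (pt s F 0 0) (pt s F 1 0) := by
    rw [pt_adj_iff] <;> omega
  rw [h1, h2, PortLabeling.probe, L.next_port hadj, ite_self]

theorem corner_ports (hs : 2 ≤ s) (L : PortLabeling (grid s)) (F : Frame) :
    L.port (pt s F 0 0) (pt s F 1 0) ≠ L.port (pt s F 0 0) (pt s F 0 1) ∧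
      1 ≤ L.port (pt s F 0 0) (pt s F 1 0) ∧ L.port (pt s F 0 0) (pt s F 1 0) ≤ 2 ∧
      1 ≤ L.port (pt s F 0 0) (pt s F 0 1) ∧ L.port (pt s F 0 0) (pt s F 0 1) ≤ 2 := by
  have h1 : (grid s).Adj (pt s F 0 0) (pt s F 1 0) := by rw [pt_adj_iff] <;> omega
  have h2 : (grid s).Adj (pt s F 0 0) (pt s F 0 1) := by rw [pt_adj_iff] <;> omega
  have h3 := L.port_mem h1
  have h4 := L.port_mem h2
  rw [deg_corner hs] at h3 h4
  refine ⟨fun e => ?_, h3.1, h3.2, h4.1, h4.2⟩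
  have := pt_inj (by omega) (by omega) (by omega) (by omega) (L.port_inj h1 h2 e)
  omega

theorem step_corner (hs : 2 ≤ s) (F : Frame) (c : Bool) :
    L.step c (L.arrive (pt s F 0 0) (pt s F 0 1)) = L.arrive (pt s F 1 0) (pt s F 0 0) := by
  apply step_corner_of_port hs
  have := corner_ports hs L F
  split <;> omega

/-- For an arbitrary `b` the side taken is not known in advance, but it is the first axis of either
a frame or its transpose. -/
theorem exists_step_corner (hs : 2 ≤ s) {v : Fin s × Fin s} (hv : deg (grid s) v = 2) (b : ℕ)
    (c : Bool) : ∃ F, v = pt s F 0 0 ∧ L.step c (v, b) = L.arrive (pt s F 1 0) (pt s F 0 0) := by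
  obtain ⟨F, rfl⟩ := exists_frame_of_deg_two hs hv
  have h := corner_ports hs L F
  by_cases hp : L.port (pt s F 0 0) (pt s F 1 0) = if b = 1 then 2 else 1
  · exact ⟨F, rfl, step_corner_of_port hs c hp⟩
  · refine ⟨F.transpose, by rw [pt_transpose], ?_⟩
    have := step_corner_of_port (L := L) (F := F.transpose) (b := b) hs c (by
      rw [pt_transpose, pt_transpose]; split_ifs at hp ⊢ <;> omega)
    rw [pt_transpose F 0 0] at this ⊢
    exact this

/-- The port labels at a corner single out a frame there, so all robots at the corner refer to the
same coordinates. -/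
theorem exists_corner_frame (hs : 2 ≤ s) (L : PortLabeling (grid s)) {v : Fin s × Fin s}
    (hv : deg (grid s) v = 2) : ∃ F, v = pt s F 0 0 ∧ L.port (pt s F 0 0) (pt s F 1 0) = 1 ∧
      L.port (pt s F 0 0) (pt s F 0 1) = 2 := by
  obtain ⟨F, rfl⟩ := exists_frame_of_deg_two hs hv
  have h := corner_ports hs L F
  by_cases hp : L.port (pt s F 0 0) (pt s F 1 0) = 1
  · exact ⟨F, rfl, hp, by omega⟩
  · refine ⟨F.transpose, by rw [pt_transpose], ?_⟩
    simp only [pt_transpose]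
    omega

/-- Ports on the boundary obey no rule, but only the inward neighbour has degree 4. The degree of
the node reached therefore identifies the edge. -/
theorem side_facts (hs : 2 ≤ s) (L : PortLabeling (grid s)) (F : Frame) {i : ℕ} (hi : 0 < i)
    (hi' : i + 1 < s) :
    (grid s).Adj (pt s F i 0) (pt s F (i - 1) 0) ∧ (grid s).Adj (pt s F i 0) (pt s F (i + 1) 0) ∧
    (grid s).Adj (pt s F i 0) (pt s F i 1) ∧
    deg (grid s) (pt s F (i - 1) 0) ≠ 4 ∧ deg (grid s) (pt s F (i + 1) 0) ≠ 4 ∧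
    deg (grid s) (pt s F i 1) = 4 ∧
    L.port (pt s F i 0) (pt s F (i - 1) 0) ≠ L.port (pt s F i 0) (pt s F (i + 1) 0) ∧
    L.port (pt s F i 0) (pt s F (i - 1) 0) ≠ L.port (pt s F i 0) (pt s F i 1) ∧
    L.port (pt s F i 0) (pt s F (i + 1) 0) ≠ L.port (pt s F i 0) (pt s F i 1) ∧
    (1 ≤ L.port (pt s F i 0) (pt s F (i - 1) 0) ∧ L.port (pt s F i 0) (pt s F (i - 1) 0) ≤ 3) ∧
    (1 ≤ L.port (pt s F i 0) (pt s F (i + 1) 0) ∧ L.port (pt s F i 0) (pt s F (i + 1) 0) ≤ 3) ∧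
    (1 ≤ L.port (pt s F i 0) (pt s F i 1) ∧ L.port (pt s F i 0) (pt s F i 1) ≤ 3) := by
  have h1 : (grid s).Adj (pt s F i 0) (pt s F (i - 1) 0) := by rw [pt_adj_iff] <;> omega
  have h2 : (grid s).Adj (pt s F i 0) (pt s F (i + 1) 0) := by rw [pt_adj_iff] <;> omega
  have h3 : (grid s).Adj (pt s F i 0) (pt s F i 1) := by rw [pt_adj_iff] <;> omega
  have d : ∀ k < s, deg (grid s) (pt s F k 0) ≠ 4 := by
    intro k hk
    rw [deg_pt F hk (by omega), lineDeg, lineDeg]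
    split <;> split <;> simp <;> split <;> omega
  have hd := deg_side hs F hi hi'
  have p1 := L.port_mem h1
  have p2 := L.port_mem h2
  have p3 := L.port_mem h3
  rw [hd] at p1 p2 p3
  refine ⟨h1, h2, h3, d _ (by omega), d _ (by omega), deg_inner F hi hi' (by omega) (by omega),
    fun e => ?_, fun e => ?_, fun e => ?_, p1, p2, p3⟩
  · have := pt_inj (by omega) (by omega) (by omega) (by omega) (L.port_inj h1 h2 e); omega
  · have := pt_inj (by omega) (by omega) (by omega) (by omega) (L.port_inj h1 h3 e); omega
  · have := pt_inj (by omega) (by omega) (by omega) (by omega) (L.port_inj h2 h3 e); omega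

theorem step_side (hs : 2 ≤ s) (F : Frame) {i : ℕ} (hi : 0 < i) (hi' : i + 1 < s) (c : Bool) :
    L.step c (L.arrive (pt s F i 0) (pt s F (i - 1) 0)) =
      L.arrive (if c then pt s F i 1 else pt s F (i + 1) 0) (pt s F i 0) := by
  obtain ⟨h1, h2, h3, d1, d2, d3, n1, n2, n3, b1, b2, b3⟩ := side_facts hs L F hi hi'
  apply step_eq_of_probe
  rw [deg_side hs F hi hi']
  have hp : (firstPort 3 (L.port (pt s F i 0) (pt s F (i - 1) 0)) =
        L.port (pt s F i 0) (pt s F (i + 1) 0) ∧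
      secondPort 3 (L.port (pt s F i 0) (pt s F (i - 1) 0)) = L.port (pt s F i 0) (pt s F i 1)) ∨
      (firstPort 3 (L.port (pt s F i 0) (pt s F (i - 1) 0)) = L.port (pt s F i 0) (pt s F i 1) ∧
      secondPort 3 (L.port (pt s F i 0) (pt s F (i - 1) 0)) =
        L.port (pt s F i 0) (pt s F (i + 1) 0)) := by
    simp only [firstPort, secondPort]
    norm_num
    split <;> split <;> omega
  rcases hp with ⟨e1, e2⟩ | ⟨e1, e2⟩ <;> rw [e1, e2, PortLabeling.probe, L.next_port h2,
    L.next_port h3] <;> cases c <;> simp [d2, d3]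

/-- The two candidate ports are distinct, so at most one leads inward, and the probe rejects that
one. With an arbitrary `b` the direction along the side remains open. -/
theorem step_side_any (hs : 2 ≤ s) (F : Frame) {i : ℕ} (hi : 0 < i) (hi' : i + 1 < s) (b : ℕ) :
    L.step false (pt s F i 0, b) = L.arrive (pt s F (i + 1) 0) (pt s F i 0) ∨
      L.step false (pt s F i 0, b) = L.arrive (pt s F (i - 1) 0) (pt s F i 0) := by
  obtain ⟨h1, h2, h3, d1, d2, d3, n1, n2, n3, b1, b2, b3⟩ := side_facts hs L F hi hi'
  have key : L.probe (pt s F i 0) (firstPort 3 b) (secondPort 3 b) false = pt s F (i + 1) 0 ∨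
      L.probe (pt s F i 0) (firstPort 3 b) (secondPort 3 b) false = pt s F (i - 1) 0 := by
    have hp : ∀ p, 1 ≤ p → p ≤ 3 → p = L.port (pt s F i 0) (pt s F (i - 1) 0) ∨
        p = L.port (pt s F i 0) (pt s F (i + 1) 0) ∨ p = L.port (pt s F i 0) (pt s F i 1) := by
      intro p hp hp'; omega
    have hne : firstPort 3 b ≠ secondPort 3 b ∧ (1 ≤ firstPort 3 b ∧ firstPort 3 b ≤ 3) ∧
        1 ≤ secondPort 3 b ∧ secondPort 3 b ≤ 3 := by
      simp only [firstPort, secondPort]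
      norm_num
      split <;> split <;> omega
    rcases hp _ hne.2.1.1 hne.2.1.2 with e | e | e
    · right; rw [e, PortLabeling.probe, L.next_port h1]; simp [d1]
    · left; rw [e, PortLabeling.probe, L.next_port h2]; simp [d2]
    · rw [e, PortLabeling.probe, L.next_port h3]
      simp only [d3, Bool.false_eq_true, iff_false, not_true_eq_false, if_false]
      rcases hp _ hne.2.2.1 hne.2.2.2 with e' | e' | e'
      · right; rw [e', L.next_port h1]
      · left; rw [e', L.next_port h2]
      · exact absurd (e.trans e'.symm) hne.1
  rw [← deg_side hs F hi hi'] at key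
  exact key.imp step_eq_of_probe step_eq_of_probe

/-- Here orientation enters: among the ports 1 to 4, `firstPort` is the only one that differs from
the back port by 2 modulo 4. -/
theorem step_inner (hL : L.Oriented) (F : Frame) {i j : ℕ} (hi : 0 < i) (hi' : i + 1 < s)
    (hj : 0 < j) (hj' : j + 1 < s) :
    L.step false (L.arrive (pt s F i j) (pt s F i (j - 1))) =
      L.arrive (pt s F i (j + 1)) (pt s F i j) := by
  have h1 : (grid s).Adj (pt s F i j) (pt s F i (j - 1)) := by rw [pt_adj_iff] <;> omega
  have h2 : (grid s).Adj (pt s F i j) (pt s F i (j + 1)) := by rw [pt_adj_iff] <;> omega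
  have hd := deg_inner F hi hi' hj hj'
  apply step_eq_of_probe
  have p1 := L.port_mem h1
  have p2 := L.port_mem h2
  rw [hd] at p1 p2 ⊢
  have hne : pt s F i (j - 1) ≠ pt s F i (j + 1) := fun e => by
    have := pt_inj (by omega) (by omega) (by omega) (by omega) e; omega
  have ho := hL _ _ _ hd h1 h2 hne (by
    rw [Fin.ext_iff, Fin.ext_iff, pt_fst_val, pt_fst_val, pt_snd_val, pt_snd_val] <;> try omega
    cases F.swap <;> simp)
  have e : firstPort 4 (L.port (pt s F i j) (pt s F i (j - 1))) =
      L.port (pt s F i j) (pt s F i (j + 1)) := by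
    unfold Nat.ModEq at ho
    simp only [firstPort, if_true]
    split <;> omega
  have e' : secondPort 4 (L.port (pt s F i j) (pt s F i (j - 1))) =
      L.port (pt s F i j) (pt s F i (j + 1)) := by rw [← e]; simp [secondPort]
  rw [e, e', PortLabeling.probe, L.next_port h2, ite_self]

/-- Along a side. -/
theorem iterate_side (hs : 2 ≤ s) {F : Frame} {x : (Fin s × Fin s) × ℕ} {i : ℕ}
    (hx : L.step false x = L.arrive (pt s F (i + 1) 0) (pt s F i 0)) (k : ℕ) (hk : i + 1 + k < s) :
    (L.step false)^[k + 1] x = L.arrive (pt s F (i + 1 + k) 0) (pt s F (i + k) 0) := by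
  induction k with
  | zero => simpa using hx
  | succ k ih =>
    rw [Function.iterate_succ_apply', ih (by omega)]
    have := step_side (L := L) (i := i + 1 + k) hs F (by omega) (by omega) false
    simpa [show i + 1 + k - 1 = i + k by omega, show i + (k + 1) = i + 1 + k by omega,
      show i + 1 + (k + 1) = i + 1 + k + 1 by omega] using this

/-- Along a line in the interior. -/
theorem iterate_line (hL : L.Oriented) {F : Frame} {i j : ℕ} (hi : 0 < i) (hi' : i + 1 < s)
    (k : ℕ) (hk : j + 1 + k < s) :
    (L.step false)^[k] (L.arrive (pt s F i (j + 1)) (pt s F i j)) =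
      L.arrive (pt s F i (j + 1 + k)) (pt s F i (j + k)) := by
  induction k with
  | zero => rfl
  | succ k ih =>
    rw [Function.iterate_succ_apply', ih (by omega)]
    have := step_inner hL F hi hi' (j := j + 1 + k) (by omega) (by omega)
    simpa [show j + 1 + k - 1 = j + k by omega, show j + (k + 1) = j + 1 + k by omega,
      show j + 1 + (k + 1) = j + 1 + k + 1 by omega] using this

/-- From a node on a side, the walk goes along the side to a corner. -/
theorem exists_iterate_of_side (hs : 2 ≤ s) {v : Fin s × Fin s} (hv : deg (grid s) v = 3) (b : ℕ) :
    ∃ n, n + 1 < s ∧ deg (grid s) ((L.step false)^[n] (v, b)).1 = 2 ∧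
      ∀ m < n, deg (grid s) ((L.step false)^[m] (v, b)).1 ≠ 2 := by
  obtain ⟨F, i, hi, hi', rfl⟩ := exists_frame_of_deg_three hs hv
  have key : ∀ (F : Frame) (i : ℕ), 0 < i → i + 1 < s →
      L.step false (pt s F i 0, b) = L.arrive (pt s F (i + 1) 0) (pt s F i 0) →
      ∃ n, n + 1 < s ∧ deg (grid s) ((L.step false)^[n] (pt s F i 0, b)).1 = 2 ∧
        ∀ m < n, deg (grid s) ((L.step false)^[m] (pt s F i 0, b)).1 ≠ 2 := by
    intro F i hi hi' hx
    refine ⟨s - 1 - i, by omega, ?_, fun m hm => ?_⟩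
    · obtain ⟨k, hk⟩ : ∃ k, s - 1 - i = k + 1 := ⟨s - 2 - i, by omega⟩
      rw [hk, iterate_side hs hx k (by omega)]
      show deg (grid s) (pt s F (i + 1 + k) 0) = 2
      have := deg_corner hs F.mirror
      rwa [pt_mirror F (by omega) (by omega), show s - 1 - 0 = i + 1 + k by omega] at this
    · cases m with
      | zero => simpa using by rw [deg_side hs F hi hi']; omega
      | succ m =>
        rw [iterate_side hs hx m (by omega)]
        show deg (grid s) (pt s F (i + 1 + m) 0) ≠ 2
        rw [deg_side hs F (by omega) (by omega)]
        omega
  rcases step_side_any (L := L) hs F hi hi' b with h | h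
  · exact key F i hi hi' h
  · have e : pt s F i 0 = pt s F.mirror (s - 1 - i) 0 := by
      rw [pt_mirror F (by omega) (by omega)]; congr 1; omega
    have e' : pt s F (i - 1) 0 = pt s F.mirror (s - 1 - i + 1) 0 := by
      rw [pt_mirror F (by omega) (by omega)]; congr 1; omega
    rw [e, e'] at h
    rw [e]
    exact key F.mirror (s - 1 - i) (by omega) (by omega) h

/-- From every node, the walk goes to a corner. -/
theorem exists_iterate_corner (hs : 2 ≤ s) (hL : L.Oriented) (v : Fin s × Fin s) {b : ℕ}
    (hb : 1 ≤ b) (hb' : b ≤ 4) :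
    ∃ n, n ≤ 2 * (s - 1) ∧ deg (grid s) ((L.step false)^[n] (v, b)).1 = 2 ∧
      ∀ m < n, deg (grid s) ((L.step false)^[m] (v, b)).1 ≠ 2 := by
  have h2 := two_le_deg hs v
  have h4 := deg_le_four v
  obtain hv | hv | hv : deg (grid s) v = 2 ∨ deg (grid s) v = 3 ∨ deg (grid s) v = 4 := by omega
  · exact ⟨0, by omega, hv, by omega⟩
  · obtain ⟨n, h, h'⟩ := exists_iterate_of_side (L := L) hs hv b
    exact ⟨n, by omega, h'⟩
  · obtain ⟨hadj, hstep⟩ := exists_step_inner (L := L) hv hb hb'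
    obtain ⟨F, i, j, hi, hi', hj, hj', hv', hw⟩ := exists_frame_of_deg_four hv hadj
    rw [hw, hv'] at hstep
    have hline : ∀ k, j + 1 + k < s → (L.step false)^[k + 1] (v, b) =
        L.arrive (pt s F i (j + 1 + k)) (pt s F i (j + k)) := by
      intro k hk
      rw [Function.iterate_succ_apply, hv', hstep]
      exact iterate_line hL hi hi' k hk
    obtain ⟨k, hk⟩ : ∃ k, j + 1 + k = s - 1 := ⟨s - 2 - j, by omega⟩
    have hside : deg (grid s) (pt s F i (j + 1 + k)) = 3 := by
      rw [hk, deg_pt F (by omega) (by omega), lineDeg, lineDeg, if_pos hi, if_pos hi',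
        if_pos (by omega), if_neg (by omega)]
    obtain ⟨n, hn, h1, h1'⟩ := exists_iterate_of_side (L := L) hs hside
      (L.port (pt s F i (j + 1 + k)) (pt s F i (j + k)))
    have hsplit : ∀ m, (L.step false)^[m + (k + 1)] (v, b) = (L.step false)^[m]
        (pt s F i (j + 1 + k), L.port (pt s F i (j + 1 + k)) (pt s F i (j + k))) := by
      intro m
      rw [Function.iterate_add_apply, hline k (by omega)]
      rfl
    refine ⟨n + (k + 1), by omega, by rw [hsplit]; exact h1, fun m hm => ?_⟩
    by_cases hm' : m < k + 1
    · cases m with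
      | zero => simp only [Function.iterate_zero, id_eq]; omega
      | succ m =>
        rw [hline m (by omega)]
        show deg (grid s) (pt s F i (j + 1 + m)) ≠ 2
        rw [deg_inner F hi hi' (by omega) (by omega)]
        omega
    · obtain ⟨m', rfl⟩ : ∃ m', m = m' + (k + 1) := ⟨m - (k + 1), by omega⟩
      rw [hsplit]
      exact h1' _ (by omega)

/-- From a corner, the walk reaches the next corner after exactly `s - 1` steps. -/
theorem iterate_from_corner (hs : 2 ≤ s) {v : Fin s × Fin s} (hv : deg (grid s) v = 2) (b : ℕ) :
    deg (grid s) ((L.step false)^[s - 1] (v, b)).1 = 2 ∧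
      ∀ m, 0 < m → m < s - 1 → deg (grid s) ((L.step false)^[m] (v, b)).1 ≠ 2 := by
  obtain ⟨F, rfl, hx⟩ := exists_step_corner (L := L) hs hv b false
  have hx' : L.step false (pt s F 0 0, b) = L.arrive (pt s F (0 + 1) 0) (pt s F 0 0) := by
    simpa using hx
  have hside := fun k => iterate_side hs hx' k
  constructor
  · obtain ⟨k, hk⟩ : ∃ k, s - 1 = k + 1 := ⟨s - 2, by omega⟩
    rw [hk, hside k (by omega)]
    show deg (grid s) (pt s F (0 + 1 + k) 0) = 2
    have := deg_corner hs F.mirror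
    rwa [pt_mirror F (by omega) (by omega), show s - 1 - 0 = 0 + 1 + k by omega] at this
  · intro m hm hm'
    obtain ⟨k, rfl⟩ : ∃ k, m = k + 1 := ⟨m - 1, by omega⟩
    rw [hside k (by omega)]
    show deg (grid s) (pt s F (0 + 1 + k) 0) ≠ 2
    rw [deg_side hs F (by omega) (by omega)]
    omega

/-- From a corner, with the port leading back along one side, along the other side. -/
theorem iterate_rot (hs : 2 ≤ s) (F : Frame) :
    (L.step false)^[s - 1] (L.arrive (pt s F 0 0) (pt s F 0 1)) =
      L.arrive (pt s F.rot 0 0) (pt s F.rot 0 1) := by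
  obtain ⟨k, hk⟩ : ∃ k, s - 1 = k + 1 := ⟨s - 2, by omega⟩
  have hx : L.step false (L.arrive (pt s F 0 0) (pt s F 0 1)) =
      L.arrive (pt s F (0 + 1) 0) (pt s F 0 0) := by simpa using step_corner hs F false
  rw [hk, iterate_side hs hx k (by omega), pt_rot F (by omega) (by omega),
    pt_rot F (by omega) (by omega)]
  congr 2 <;> omega

end Grid

/-! ### The algorithm -/

/-- The instructions that a robot follows once it knows the size of the grid. Each takes four
rounds. -/
inductive Instr
  | wait
  | advance
  | turn
  | seek
  | setBack (b : ℕ)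
  | collect
  | listen
  | tick (col : Bool) (w : ℕ)
  | settle (q h : ℕ)
  | place
  | approach (w : ℕ)
  | halt

/-- What a robot remembers between two instructions. -/
structure State where
  todo : List Instr
  clock : ℕ
  count : ℕ
  back : ℕ
  known : Finset ℕ
  group : Finset ℕ
  base : Finset ℕ
  rows : Finset (ℕ × ℕ)
  cols : Finset (ℕ × ℕ)
  slot : Option (ℕ × ℕ)

/-- The back port 3 is a fictitious entry port; any value from 1 to 4 would give a valid first
direction. -/
def State.initial : State := ⟨[], 0, 0, 3, ∅, ∅, ∅, ∅, ∅, none⟩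

/-- What a robot does in the four rounds of an instruction: stay, be absent for one round, or
go to a neighbour. -/
inductive Motion
  | stay
  | blink
  | go (p p' : ℕ) (inward : Bool)
  | halt

def Motion.walk (inward : Bool) (d b : ℕ) : Motion := .go (firstPort d b) (secondPort d b) inward

def Motion.isGo : Motion → Bool
  | .go _ _ _ => true
  | _ => false

/-- The motion of a robot at a node of degree `d`. -/
def State.motion (σ : State) (d : ℕ) : Motion :=
  match σ.todo with
  | [] => if d = 2 ∧ σ.count ≠ 0 then .stay else .walk false d σ.back
  | .advance :: _ => match σ.slot with
    | none => .walk false d σ.back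
    | some _ => .stay
  | .turn :: _ => .walk true d σ.back
  | .seek :: _ => if d = 2 then .stay else .walk false d σ.back
  | .tick c w :: _ => match σ.slot with
    | none => .stay
    | some (i, j) => if w = (if c then j else i) then .blink else .stay
  | .approach w :: _ => match σ.slot with
    | none => .stay
    | some (i, j) =>
      if w < i ∨ (i < w ∧ w < i + j) then .walk false d σ.back
      else if w = i ∧ 0 < j then .walk true d σ.back
      else .stay
  | .halt :: _ => .halt
  | _ :: _ => .stay

/-- The number of slots that belong to one corner is the square of this number. -/
def slotSide (s : ℕ) : ℕ := if s % 2 = 0 then s / 2 else s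

/-- On a grid of odd side length, all robots meet at one corner. -/
def gatherProgram (s : ℕ) : List Instr :=
  if s % 2 = 0 then [] else
    List.replicate (s / 2) .advance ++ .turn :: (List.replicate (s / 2 - 1) .advance ++
      .setBack 3 :: List.replicate (2 * s) .seek)

/-- The robots that have a slot announce it by being absent at the right times. Then the robots
without a slot that have come by port `q` choose. -/
def chooseProgram (q h : ℕ) : List Instr :=
  .listen :: ((List.range h).map (.tick false) ++ ((List.range h).map (.tick true) ++
    [.settle q h]))

/-- Groups at the same corner differ in their entry port, 1 or 2. The second group listens anew
after the first has chosen, so it also hears the slots just taken. -/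
def stageProgram (s : ℕ) : List Instr :=
  List.replicate (s - 1) .advance ++
    (chooseProgram 1 (slotSide s) ++ chooseProgram 2 (slotSide s))

def approachProgram (s : ℕ) : List Instr :=
  .place :: ((List.range (2 * s)).map .approach ++ [.halt])

/-- With the fictitious back port 2, all robots at a corner choose together at first, and those left
over leave by port 1. Three stages lead them to the other three corners. -/
def dispersionProgram (s : ℕ) : List Instr :=
  .setBack 2 :: .collect :: .settle 2 (slotSide s) ::
    (stageProgram s ++ (stageProgram s ++ (stageProgram s ++ approachProgram s)))

def program (s : ℕ) : List Instr := gatherProgram s ++ dispersionProgram s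

/-- Record `w` for the elements of `base` that are absent for the first time. -/
def record (base P : Finset ℕ) (w : ℕ) (r : Finset (ℕ × ℕ)) : Finset (ℕ × ℕ) :=
  r ∪ ((base \ P).filter fun x => x ∉ r.image Prod.fst).image fun x => (x, w)

/-- The slots that nobody has announced. -/
noncomputable def freeSlots (h : ℕ) (rows cols : Finset (ℕ × ℕ)) : List (ℕ × ℕ) :=
  ((Finset.range h ×ˢ Finset.range h).filter fun p =>
    ¬ ∃ x ∈ rows.image Prod.fst, (x, p.1) ∈ rows ∧ (x, p.2) ∈ cols).toList

def rank (S : Finset ℕ) (x : ℕ) : ℕ := (S.filter (· < x)).card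

/-- The state after an instruction, for the robot `x` that has started at a node of degree `d`, has
arrived by port `e` (if it has moved) and has seen the robots `P` (if it has stayed). -/
noncomputable def State.update (x : ℕ) (σ : State) (d e : ℕ) (P : Finset ℕ) : State :=
  let τ : State := { σ with
    todo := σ.todo.tail
    back := if (σ.motion d).isGo then e else σ.back }
  match σ.todo with
  | [] =>
    if d = 2 ∧ σ.count ≠ 0 then
      -- `count + 1` is the side length. The waiting time makes all robots begin the program in the
      -- same macro round, however long their search has taken.
      { τ with todo := List.replicate (3 * (σ.count + 1) - (σ.clock + 1)) .wait ++
                program (σ.count + 1) }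
    else { τ with
      clock := σ.clock + 1
      count := if d ≠ 2 ∧ σ.count = 0 then 0 else σ.count + 1 }
  | .setBack b :: _ => { τ with back := b }
  | .collect :: _ => { τ with known := P, group := P, rows := ∅, cols := ∅ }
  | .listen :: _ => match σ.slot with
    -- Each identifier is charged only once: those already accounted for can block no further slot.
    | none => { τ with base := P \ σ.known, rows := ∅, cols := ∅ }
    | some _ => τ
  | .tick c w :: _ => match σ.slot with
    | none => if c then { τ with cols := record σ.base P w σ.cols }
        else { τ with rows := record σ.base P w σ.rows }
    | some _ => τ
  | .settle q h :: _ =>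
    if σ.slot = none ∧ σ.back = q then { τ with
      -- Every identifier heard in the row ticks becomes known, whether or not it has announced a
      -- column. The identifiers of rank below the number of free slots leave the group.
      known := σ.known ∪ σ.rows.image Prod.fst
      group := σ.group.filter fun y => (freeSlots h σ.rows σ.cols).length ≤ rank σ.group y
      slot := (freeSlots h σ.rows σ.cols)[rank σ.group x]? }
    else τ
  | .place :: _ => match σ.slot with
    | none => τ
    -- At a corner, back port 1 makes the walk leave by port 2 and conversely. A slot in row 0 is
    -- reached along the second axis from the start.
    | some (i, _) => { τ with back := if i = 0 then 1 else 2 }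
  | _ => τ

/-- The memory of a robot: the state, and the progress within an instruction. -/
structure Memory where
  phase : ℕ
  state : State
  degree : ℕ
  port : ℕ

def Memory.initial : Memory := ⟨0, .initial, 0, 0⟩

/-! ### Encoding of the memory as a bit string -/

def Instr.toTriple : Instr → ℕ × ℕ × ℕ
  | .wait => (0, 0, 0)
  | .advance => (1, 0, 0)
  | .turn => (2, 0, 0)
  | .seek => (3, 0, 0)
  | .setBack b => (4, b, 0)
  | .collect => (5, 0, 0)
  | .listen => (6, 0, 0)
  | .tick c w => (7, c.toNat, w)
  | .settle q h => (8, q, h)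
  | .place => (9, 0, 0)
  | .approach w => (10, w, 0)
  | .halt => (11, 0, 0)

theorem Instr.toTriple_injective : Function.Injective Instr.toTriple := by
  intro a b h
  cases a <;> cases b <;> simp [toTriple] at h ⊢ <;> try exact h
  next c _ c' _ => exact ⟨by cases c <;> cases c' <;> simp_all, h.2⟩

def pairNatCode : ℕ × ℕ → List Bool := pairCode natCode natCode

def instrCode : Instr → List Bool := pairCode natCode pairNatCode ∘ Instr.toTriple

def slotCode : Option (ℕ × ℕ) → List Bool := listCode pairNatCode ∘ Option.toList

abbrev Memory.Tuple : Type :=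
  ((ℕ × ℕ × ℕ) × ℕ × ℕ × ℕ) × List Instr × Finset ℕ × Finset ℕ × Finset ℕ ×
    Finset (ℕ × ℕ) × Finset (ℕ × ℕ) × Option (ℕ × ℕ)

def Memory.toTuple (m : Memory) : Memory.Tuple :=
  (((m.phase, m.degree, m.port), m.state.clock, m.state.count, m.state.back), m.state.todo,
    m.state.known, m.state.group, m.state.base, m.state.rows, m.state.cols, m.state.slot)

theorem Memory.toTuple_injective : Function.Injective Memory.toTuple := by
  rintro ⟨a, ⟨b1, b2, b3, b4, b5, b6, b7, b8, b9, b10⟩, c, d⟩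
    ⟨a', ⟨b1', b2', b3', b4', b5', b6', b7', b8', b9', b10'⟩, c', d'⟩ h
  simp only [Memory.toTuple, Prod.mk.injEq] at h
  simp [h]

noncomputable def tupleCode : Memory.Tuple → List Bool :=
  pairCode (pairCode (pairCode natCode pairNatCode) (pairCode natCode pairNatCode))
    (pairCode (listCode instrCode) (pairCode (finsetCode natCode) (pairCode (finsetCode natCode)
      (pairCode (finsetCode natCode) (pairCode (finsetCode pairNatCode)
        (pairCode (finsetCode pairNatCode) slotCode))))))

theorem isPrefixCode_tupleCode : IsPrefixCode tupleCode := by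
  have h1 := isPrefixCode_natCode
  have h2 : IsPrefixCode pairNatCode := h1.pair h1
  have h3 : IsPrefixCode instrCode := (h1.pair h2).comp Instr.toTriple_injective
  have h4 : IsPrefixCode slotCode := h2.list.comp fun a b h => by
    cases a <;> cases b <;> simp_all
  exact ((h1.pair h2).pair (h1.pair h2)).pair (h3.list.pair (h1.finset.pair (h1.finset.pair
    (h1.finset.pair (h2.finset.pair (h2.finset.pair h4))))))

/-- The memory as a bit string. -/
noncomputable def Memory.save (m : Memory) : List Bool := true :: tupleCode m.toTuple

theorem Memory.save_injective : Function.Injective Memory.save := fun a b h =>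
  Memory.toTuple_injective (isPrefixCode_tupleCode.injective (by simpa [Memory.save] using h))

open Classical in
noncomputable def Memory.load (l : List Bool) : Memory :=
  if h : ∃ m : Memory, m.save = l then h.choose else .initial

theorem Memory.load_save (m : Memory) : Memory.load m.save = m := by
  have h : ∃ m' : Memory, m'.save = m.save := ⟨m, rfl⟩
  rw [Memory.load, dif_pos h]
  exact Memory.save_injective h.choose_spec

/-- Every saved memory begins with the bit `true`, so the empty string in which a robot starts is
not a code word. -/
theorem Memory.load_nil : Memory.load [] = .initial := by
  rw [Memory.load, dif_neg]
  rintro ⟨m, h⟩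
  simp [Memory.save] at h

/-- One round of the algorithm, before the memory is written as a bit string. -/
noncomputable def roundStep (x : ℕ) (m : Memory) (o : Observation) : Memory × Action :=
  match m.phase with
  | 0 =>
    let m' : Memory := ⟨1, m.state, o.degree, 0⟩
    match m.state.motion o.degree with
    | .stay => (m', .stay)
    | .blink => (m', .move 1)
    | .go p _ _ => (m', .move p)
    | .halt => (m', .halt)
  | 1 =>
    let e := o.entryPort.getD 0
    match m.state.motion m.degree with
    | .blink => (⟨2, m.state.update x m.degree 0 ∅, 0, 0⟩, .move e)
    | .go _ p' c =>
      if o.degree = 4 ↔ c = true then (⟨2, m.state.update x m.degree e ∅, 0, 0⟩, .stay)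
      else (⟨3, m.state, m.degree, p'⟩, .move e)
    | _ => (⟨2, m.state.update x m.degree 0 (insert x (o.others.image Prod.fst)), 0, 0⟩, .stay)
  -- Phases 2 and 4 are idle rounds that pad the short instructions to the length of a failed probe.
  | 2 => (⟨4, m.state, 0, 0⟩, .stay)
  | 3 => (⟨5, m.state, m.degree, 0⟩, .move m.port)
  | 4 => (⟨0, m.state, 0, 0⟩, .stay)
  | _ => (⟨0, m.state.update x m.degree (o.entryPort.getD 0) ∅, 0, 0⟩, .stay)

noncomputable def robotAlgorithm : Algorithm := fun x l o =>
  ((roundStep x (Memory.load l) o).1.save, (roundStep x (Memory.load l) o).2)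

/-! ### The effect of one instruction -/

section Execution

variable {V R : Type} [Fintype R] {G : SimpleGraph V} {E : History V R} {L : PortLabeling G}
  {ident : R → ℕ} {B : Finset R}

open Classical in
/-- The identifiers that can be perceived at the node `v` in round `t`. -/
noncomputable def History.crowd (E : History V R) (ident : R → ℕ) (t : ℕ) (v : V) : Finset ℕ :=
  (Finset.univ.filter fun j => E.present t j ∧ (E.state t j).pos = v).image ident

theorem mem_crowd {t : ℕ} {v : V} {x : ℕ} :
    x ∈ E.crowd ident t v ↔ ∃ j, E.present t j ∧ (E.state t j).pos = v ∧ ident j = x := by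
  simp [History.crowd, and_assoc]

/-- Once a robot adds its own identifier, what it sees depends only on the node and the round. This
is what keeps the robots of a group in agreement. -/
theorem insert_others {t : ℕ} {i : R} (h : E.present t i) :
    insert (ident i) ((E.observe G ident t i).others.image Prod.fst) =
      E.crowd ident t (E.state t i).pos := by
  classical
  ext x
  rw [mem_crowd]
  simp only [History.observe, Finset.mem_insert, Finset.mem_image, Finset.mem_filter,
    Finset.mem_univ, true_and]
  constructor
  · rintro (rfl | ⟨_, ⟨j, ⟨-, h1, h2⟩, rfl⟩, rfl⟩)
    · exact ⟨i, h, rfl, rfl⟩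
    · exact ⟨j, h1, h2, rfl⟩
  · rintro ⟨j, h1, h2, rfl⟩
    by_cases hj : j = i
    · exact Or.inl (by rw [hj])
    · exact Or.inr ⟨_, ⟨j, ⟨hj, h1, h2⟩, rfl⟩, rfl⟩

theorem apply_move {q : RobotState V} {m : List Bool} {w : V} (h : G.Adj q.pos w) :
    q.apply L m (.move (L.port q.pos w)) = ⟨w, some (L.port w q.pos), m, false⟩ := by
  have h' : ∃ u, G.Adj q.pos u ∧ L.port q.pos u = L.port q.pos w := ⟨w, h, rfl⟩
  have e : h'.choose = w := L.port_inj h'.choose_spec.1 h h'.choose_spec.2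
  simp only [RobotState.apply]
  rw [dif_pos h', e]

/-- The robot `i` is at `v` in round `t`, active, with memory `m`. -/
structure History.IsAt (E : History V R) (t : ℕ) (i : R) (v : V) (e : Option ℕ) (m : Memory) :
    Prop where
  pos : (E.state t i).pos = v
  entry : (E.state t i).entryPort = e
  memory : Memory.load (E.state t i).memory = m
  active : (E.state t i).halted = false

theorem History.IsAt.next (hE : E.IsExecution robotAlgorithm L ident B) {t : ℕ} {i : R} {v : V}
    {e : Option ℕ} {m : Memory} (h : E.IsAt t i v e m) (hi : i ∉ B) :
    E.state (t + 1) i = RobotState.apply L ⟨v, e, (E.state t i).memory, false⟩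
      (roundStep (ident i) m (E.observe G ident t i)).1.save
      (roundStep (ident i) m (E.observe G ident t i)).2 := by
  obtain ⟨h1, h2, h3, h4⟩ := h
  have := hE.step t i hi h4
  simp only [robotAlgorithm] at this
  rw [h3] at this
  rw [this]
  congr 1
  rw [← h1, ← h2, ← h4]

theorem History.IsAt.next_stay (hE : E.IsExecution robotAlgorithm L ident B) {t : ℕ} {i : R} {v : V}
    {e : Option ℕ} {m m' : Memory} (h : E.IsAt t i v e m) (hi : i ∉ B)
    (hm : roundStep (ident i) m (E.observe G ident t i) = (m', .stay)) :
    E.IsAt (t + 1) i v none m' := by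
  have := h.next hE hi
  rw [hm] at this
  constructor <;> simp [this, RobotState.apply, Memory.load_save]

theorem History.IsAt.next_move (hE : E.IsExecution robotAlgorithm L ident B) {t : ℕ} {i : R} {v : V}
    {e : Option ℕ} {m m' : Memory} (h : E.IsAt t i v e m) (hi : i ∉ B) {w : V} (hw : G.Adj v w)
    (hm : roundStep (ident i) m (E.observe G ident t i) = (m', .move (L.port v w))) :
    E.IsAt (t + 1) i w (some (L.port w v)) m' := by
  have := h.next hE hi
  rw [hm] at this
  simp only at this
  rw [apply_move (q := ⟨v, e, (E.state t i).memory, false⟩) hw] at this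
  constructor <;> simp [this, Memory.load_save]

/-- The robot `i` is at `v` in state `σ` and about to begin its `τ`-th instruction. -/
def History.Ready (E : History V R) (τ : ℕ) (i : R) (v : V) (σ : State) : Prop :=
  ∃ e, E.IsAt (4 * τ) i v e ⟨0, σ, 0, 0⟩

theorem ready_zero (hE : E.IsExecution robotAlgorithm L ident B) {i : R} (hi : i ∉ B) :
    E.Ready 0 i (E.state 0 i).pos .initial := by
  obtain ⟨h1, h2, h3⟩ := hE.start i hi
  exact ⟨_, rfl, rfl, by rw [h2, Memory.load_nil]; rfl, h3⟩

theorem observe_degree {t : ℕ} {i : R} {v : V} {e : Option ℕ} {m : Memory}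
    (h : E.IsAt t i v e m) : (E.observe G ident t i).degree = deg G v := by
  simp [History.observe, h.pos]

theorem observe_entry {t : ℕ} {i : R} {v : V} {e : Option ℕ} {m : Memory}
    (h : E.IsAt t i v e m) : (E.observe G ident t i).entryPort = e := by
  simp [History.observe, h.entry]

theorem History.IsAt.finish (hE : E.IsExecution robotAlgorithm L ident B) {t : ℕ} {i : R} {v : V}
    {e : Option ℕ} {σ : State} (hi : i ∉ B) (h : E.IsAt t i v e ⟨2, σ, 0, 0⟩) :
    E.IsAt (t + 2) i v none ⟨0, σ, 0, 0⟩ := by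
  have h1 : E.IsAt (t + 1) i v none ⟨4, σ, 0, 0⟩ := h.next_stay hE hi (by simp [roundStep])
  exact h1.next_stay hE hi (by simp [roundStep])

/-- The crowd is observed at round `4 * τ + 1`, exactly when a blinking robot is away from its node.
-/
theorem History.Ready.stay (hE : E.IsExecution robotAlgorithm L ident B) {τ : ℕ} {i : R} {v : V}
    {σ : State} (h : E.Ready τ i v σ) (hi : i ∉ B) (hσ : σ.motion (deg G v) = .stay) :
    (E.state (4 * τ + 1) i).pos = v ∧
      E.Ready (τ + 1) i v
        (σ.update (ident i) (deg G v) 0 (E.crowd ident (4 * τ + 1) v)) := by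
  obtain ⟨e, h⟩ := h
  have hd := observe_degree (ident := ident) (G := G) h
  have h1 : E.IsAt (4 * τ + 1) i v none ⟨1, σ, deg G v, 0⟩ :=
    h.next_stay hE hi (by simp [roundStep, hd, hσ])
  have hP := insert_others (G := G) (ident := ident) (hE.present (4 * τ + 1) i hi)
  rw [h1.pos] at hP
  have h2 : E.IsAt (4 * τ + 1 + 1) i v none
      ⟨2, σ.update (ident i) (deg G v) 0 (E.crowd ident (4 * τ + 1) v), 0, 0⟩ :=
    h1.next_stay hE hi (by simp [roundStep, hσ, hP])
  exact ⟨h1.pos, none, h2.finish hE hi⟩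

theorem History.Ready.blink (hE : E.IsExecution robotAlgorithm L ident B) {τ : ℕ} {i : R} {v : V}
    {σ : State} (h : E.Ready τ i v σ) (hi : i ∉ B) (hv : 1 ≤ deg G v)
    (hσ : σ.motion (deg G v) = .blink) :
    (E.state (4 * τ + 1) i).pos ≠ v ∧ E.Ready (τ + 1) i v (σ.update (ident i) (deg G v) 0 ∅) := by
  obtain ⟨e, h⟩ := h
  have hd := observe_degree (ident := ident) (G := G) h
  have hw := L.adj_next le_rfl hv
  have h1 : E.IsAt (4 * τ + 1) i (L.next v 1) _ ⟨1, σ, deg G v, 0⟩ :=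
    h.next_move hE hi hw (by simp [roundStep, hd, hσ, L.port_next le_rfl hv])
  have he := observe_entry (ident := ident) (G := G) h1
  have h2 : E.IsAt (4 * τ + 1 + 1) i v _ ⟨2, σ.update (ident i) (deg G v) 0 ∅, 0, 0⟩ :=
    h1.next_move hE hi hw.symm (by simp [roundStep, hσ, he])
  refine ⟨?_, none, h2.finish hE hi⟩
  rw [h1.pos]
  exact hw.ne'

/-- A failed probe goes out, back and out again, and then needs a round to record the entry port;
this is why a macro round has four rounds. -/
theorem History.Ready.go (hE : E.IsExecution robotAlgorithm L ident B) {τ : ℕ} {i : R} {v : V}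
    {σ : State} (h : E.Ready τ i v σ) (hi : i ∉ B) {p p' : ℕ} {c : Bool} (hp : 1 ≤ p)
    (hp' : p ≤ deg G v) (hq : 1 ≤ p') (hq' : p' ≤ deg G v)
    (hσ : σ.motion (deg G v) = .go p p' c) :
    E.Ready (τ + 1) i (L.probe v p p' c)
      (σ.update (ident i) (deg G v) (L.port (L.probe v p p' c) v) ∅) := by
  obtain ⟨e, h⟩ := h
  have hd := observe_degree (ident := ident) (G := G) h
  have hw := L.adj_next hp hp'
  have h1 : E.IsAt (4 * τ + 1) i (L.next v p) _ ⟨1, σ, deg G v, 0⟩ :=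
    h.next_move hE hi hw (by simp [roundStep, hd, hσ, L.port_next hp hp'])
  have he := observe_entry (ident := ident) (G := G) h1
  have hd1 := observe_degree (ident := ident) (G := G) h1
  unfold PortLabeling.probe
  split
  next hc =>
    have h2 : E.IsAt (4 * τ + 1 + 1) i (L.next v p) _
        ⟨2, σ.update (ident i) (deg G v) (L.port (L.next v p) v) ∅, 0, 0⟩ :=
      h1.next_stay hE hi (by simp [roundStep, hσ, he, hd1, hc])
    exact ⟨none, h2.finish hE hi⟩
  next hc =>
    have hw' := L.adj_next hq hq'
    have h2 : E.IsAt (4 * τ + 1 + 1) i v _ ⟨3, σ, deg G v, p'⟩ :=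
      h1.next_move hE hi hw.symm (by simp [roundStep, hσ, he, hd1, hc])
    have h3 : E.IsAt (4 * τ + 1 + 1 + 1) i (L.next v p') _ ⟨5, σ, deg G v, 0⟩ :=
      h2.next_move hE hi hw' (by simp [roundStep, L.port_next hq hq'])
    have he3 := observe_entry (ident := ident) (G := G) h3
    have h4 : E.IsAt (4 * τ + 1 + 1 + 1 + 1) i (L.next v p') none
        ⟨0, σ.update (ident i) (deg G v) (L.port (L.next v p') v) ∅, 0, 0⟩ :=
      h3.next_stay hE hi (by simp [roundStep, he3])
    exact ⟨none, h4⟩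

theorem History.Ready.walk (hE : E.IsExecution robotAlgorithm L ident B) {τ : ℕ} {i : R} {v : V}
    {σ : State} (h : E.Ready τ i v σ) (hi : i ∉ B) {c : Bool} (hv : 2 ≤ deg G v)
    (hb : 1 ≤ σ.back) (hb' : σ.back ≤ 4)
    (hσ : σ.motion (deg G v) = .walk c (deg G v) σ.back) :
    E.Ready (τ + 1) i (L.step c (v, σ.back)).1
      (σ.update (ident i) (deg G v) (L.step c (v, σ.back)).2 ∅) := by
  have h1 := firstPort_bounds hv hb hb'
  have h2 := secondPort_bounds hv hb hb'
  exact h.go hE hi h1.1 h1.2 h2.1 h2.2 hσ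

theorem History.Ready.halt (hE : E.IsExecution robotAlgorithm L ident B) {τ : ℕ} {i : R} {v : V}
    {σ : State} (h : E.Ready τ i v σ) (hi : i ∉ B) (hσ : σ.motion (deg G v) = .halt)
    {t : ℕ} (ht : 4 * τ + 1 ≤ t) : (E.state t i).pos = v ∧ (E.state t i).halted = true := by
  obtain ⟨e, h⟩ := h
  have hd := observe_degree (ident := ident) (G := G) h
  induction t, ht using Nat.le_induction with
  | base =>
    rw [h.next hE hi]
    simp [roundStep, hd, hσ, RobotState.apply]
  | succ t _ ih => rwa [hE.frozen t i hi ih.2]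

end Execution

/-! ### Finding a corner and the size of the grid, and gathering on odd grids -/

section Phases

variable {s : ℕ} {R : Type} [Fintype R] {E : History (Fin s × Fin s) R}
  {L : PortLabeling (grid s)} {ident : R → ℕ} {B : Finset R}

theorem step_bounds [NeZero s] (hs : 2 ≤ s) {c : Bool} {x : (Fin s × Fin s) × ℕ} (hb : 1 ≤ x.2)
    (hb' : x.2 ≤ 4) : 1 ≤ (L.step c x).2 ∧ (L.step c x).2 ≤ 4 := by
  have hd := two_le_deg hs x.1
  have h1 := firstPort_bounds hd hb hb'
  have h2 := secondPort_bounds hd hb hb'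
  have h : (grid s).Adj (L.step c x).1 x.1 := by
    simp only [PortLabeling.step, PortLabeling.probe]
    split
    · exact (L.adj_next h1.1 h1.2).symm
    · exact (L.adj_next h2.1 h2.2).symm
  have := L.port_mem h
  exact ⟨this.1, this.2.trans (deg_le_four _)⟩

theorem iterate_bounds [NeZero s] (hs : 2 ≤ s) {x : (Fin s × Fin s) × ℕ}
    (hb : 1 ≤ x.2) (hb' : x.2 ≤ 4)
    (k : ℕ) : 1 ≤ ((L.step false)^[k] x).2 ∧ ((L.step false)^[k] x).2 ≤ 4 := by
  induction k with
  | zero => exact ⟨hb, hb'⟩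
  | succ k ih => rw [Function.iterate_succ_apply']; exact step_bounds hs ih.1 ih.2

theorem ready_wait (hE : E.IsExecution robotAlgorithm L ident B) {i : R} (hi : i ∉ B)
    {v : Fin s × Fin s} {l : List Instr} (k : ℕ) {τ : ℕ} {σ : State} (h : E.Ready τ i v σ)
    (hl : σ.todo = List.replicate k .wait ++ l) : E.Ready (τ + k) i v { σ with todo := l } := by
  induction k generalizing τ σ with
  | zero => obtain ⟨⟩ := σ; simp at hl; subst hl; exact h
  | succ k ih =>
    rw [List.replicate_succ, List.cons_append] at hl
    have h1 := (h.stay hE hi (by simp [State.motion, hl])).2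
    have h2 := ih h1 (by simp [State.update, hl])
    simpa [State.update, hl, State.motion, Motion.isGo, add_assoc, add_comm 1 k] using h2

theorem ready_advance [NeZero s] (hs : 2 ≤ s) (hE : E.IsExecution robotAlgorithm L ident B) {i : R}
    (hi : i ∉ B) {l : List Instr} (k : ℕ) {τ : ℕ} {v : Fin s × Fin s} {σ : State}
    (h : E.Ready τ i v σ) (hl : σ.todo = List.replicate k .advance ++ l) (hσ : σ.slot = none)
    (hb : 1 ≤ σ.back) (hb' : σ.back ≤ 4) :
    E.Ready (τ + k) i ((L.step false)^[k] (v, σ.back)).1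
      { σ with todo := l, back := ((L.step false)^[k] (v, σ.back)).2 } := by
  induction k generalizing τ v σ with
  | zero => obtain ⟨⟩ := σ; simp at hl; subst hl; exact h
  | succ k ih =>
    rw [List.replicate_succ, List.cons_append] at hl
    have h1 := h.walk hE hi (c := false) (two_le_deg hs v) hb hb'
      (by simp [State.motion, hl, hσ])
    have h3 := step_bounds (L := L) (c := false) hs (x := (v, σ.back)) hb hb'
    have h2 := ih h1 (by simp [State.update, hl]) (by simp [State.update, hl, hσ])
      (by simpa [State.update, hl, State.motion, hσ, Motion.isGo, Motion.walk] using h3.1)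
      (by simpa [State.update, hl, State.motion, hσ, Motion.isGo, Motion.walk] using h3.2)
    rw [Function.iterate_succ_apply]
    simpa [State.update, hl, State.motion, hσ, Motion.isGo, Motion.walk, add_assoc, add_comm 1 k]
      using h2

theorem ready_advance_settled (hE : E.IsExecution robotAlgorithm L ident B) {i : R} (hi : i ∉ B)
    {v : Fin s × Fin s} {l : List Instr} (k : ℕ) {τ : ℕ} {σ : State} (h : E.Ready τ i v σ)
    (hl : σ.todo = List.replicate k .advance ++ l) (hσ : σ.slot ≠ none) :
    E.Ready (τ + k) i v { σ with todo := l } := by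
  obtain ⟨p, hp⟩ := Option.ne_none_iff_exists'.1 hσ
  induction k generalizing τ σ with
  | zero => obtain ⟨⟩ := σ; simp at hl; subst hl; exact h
  | succ k ih =>
    rw [List.replicate_succ, List.cons_append] at hl
    have h1 := (h.stay hE hi (by simp [State.motion, hl, hp])).2
    have h2 := ih h1 (by simp [State.update, hl]) (by simp [State.update, hl, hp])
      (by simp [State.update, hl, hp])
    simpa [State.update, hl, State.motion, hp, Motion.isGo, add_assoc, add_comm 1 k] using h2

/-- A step of a walk that stops at a corner. -/
noncomputable def PortLabeling.seekStep (L : PortLabeling (grid s)) (x : (Fin s × Fin s) × ℕ) :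
    (Fin s × Fin s) × ℕ :=
  if deg (grid s) x.1 = 2 then x else L.step false x

theorem ready_seek [NeZero s] (hs : 2 ≤ s) (hE : E.IsExecution robotAlgorithm L ident B) {i : R}
    (hi : i ∉ B) {l : List Instr} (k : ℕ) {τ : ℕ} {v : Fin s × Fin s} {σ : State}
    (h : E.Ready τ i v σ) (hl : σ.todo = List.replicate k .seek ++ l)
    (hb : 1 ≤ σ.back) (hb' : σ.back ≤ 4) :
    E.Ready (τ + k) i ((L.seekStep)^[k] (v, σ.back)).1
      { σ with todo := l, back := ((L.seekStep)^[k] (v, σ.back)).2 } := by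
  induction k generalizing τ v σ with
  | zero => obtain ⟨⟩ := σ; simp at hl; subst hl; exact h
  | succ k ih =>
    rw [List.replicate_succ, List.cons_append] at hl
    rw [Function.iterate_succ_apply]
    by_cases hv : deg (grid s) v = 2
    · have h1 := (h.stay hE hi (by simp [State.motion, hl, hv])).2
      have h2 := ih h1 (by simp [State.update, hl])
        (by simpa [State.update, hl, State.motion, Motion.isGo, hv] using hb)
        (by simpa [State.update, hl, State.motion, Motion.isGo, hv] using hb')
      rw [PortLabeling.seekStep, if_pos hv]
      simpa [State.update, hl, State.motion, hv, Motion.isGo, add_assoc, add_comm 1 k] using h2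
    · have h1 := h.walk hE hi (c := false) (two_le_deg hs v) hb hb'
        (by simp [State.motion, hl, hv])
      have h3 := step_bounds (L := L) (c := false) hs (x := (v, σ.back)) hb hb'
      have h2 := ih h1 (by simp [State.update, hl])
        (by simpa [State.update, hl, State.motion, hv, Motion.isGo, Motion.walk] using h3.1)
        (by simpa [State.update, hl, State.motion, hv, Motion.isGo, Motion.walk] using h3.2)
      rw [PortLabeling.seekStep, if_neg hv]
      simpa [State.update, hl, State.motion, hv, Motion.isGo, Motion.walk, add_assoc, add_comm 1 k]
        using h2

theorem iterate_seekStep_lt {x : (Fin s × Fin s) × ℕ} {k : ℕ}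
    (h : ∀ m < k, deg (grid s) ((L.step false)^[m] x).1 ≠ 2) :
    (L.seekStep)^[k] x = (L.step false)^[k] x := by
  induction k with
  | zero => rfl
  | succ k ih =>
    rw [Function.iterate_succ_apply', Function.iterate_succ_apply',
      ih fun m hm => h m (by omega), PortLabeling.seekStep, if_neg (h k (by omega))]

theorem iterate_seekStep_fixed {x : (Fin s × Fin s) × ℕ} (h : deg (grid s) x.1 = 2) (k : ℕ) :
    (L.seekStep)^[k] x = x :=
  Function.iterate_fixed (by rw [PortLabeling.seekStep, if_pos h]) k

theorem deg_iterate_seekStep [NeZero s] (hs : 2 ≤ s) (hL : L.Oriented) (v : Fin s × Fin s) {b : ℕ}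
    (hb : 1 ≤ b) (hb' : b ≤ 4) {k : ℕ} (hk : 2 * (s - 1) ≤ k) :
    deg (grid s) ((L.seekStep)^[k] (v, b)).1 = 2 ∧ 1 ≤ ((L.seekStep)^[k] (v, b)).2 ∧
      ((L.seekStep)^[k] (v, b)).2 ≤ 4 := by
  obtain ⟨n, hn, h1, h2⟩ := exists_iterate_corner hs hL v hb hb'
  obtain ⟨m, rfl⟩ : ∃ m, k = m + n := ⟨k - n, by omega⟩
  rw [Function.iterate_add_apply, iterate_seekStep_lt h2, iterate_seekStep_fixed h1]
  exact ⟨h1, iterate_bounds (x := (v, b)) hs hb hb' n⟩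

/-- In macro round `3 * s`, every robot is at a corner and knows the size of the grid. -/
theorem ready_program [NeZero s] (hs : 2 ≤ s) (hL : L.Oriented)
    (hE : E.IsExecution robotAlgorithm L ident B) {i : R} (hi : i ∉ B) :
    ∃ v σ, E.Ready (3 * s) i v σ ∧ deg (grid s) v = 2 ∧ σ.todo = program s ∧ σ.slot = none ∧
      1 ≤ σ.back ∧ σ.back ≤ 4 := by
  set v₀ := (E.state 0 i).pos
  obtain ⟨n, hn, h1, h2⟩ := exists_iterate_corner hs hL v₀ (b := 3) (by omega) (by omega)
  have hb := iterate_bounds (L := L) (x := (v₀, 3)) hs (by simp) (by simp)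
  have seek : ∀ m ≤ n, E.Ready m i ((L.step false)^[m] (v₀, 3)).1
      ⟨[], m, 0, ((L.step false)^[m] (v₀, 3)).2, ∅, ∅, ∅, ∅, ∅, none⟩ := by
    intro m
    induction m with
    | zero => intro _; exact ready_zero hE hi
    | succ m ih =>
      intro hm
      have hne := h2 m (by omega)
      have := (ih (by omega)).walk hE hi (c := false) (two_le_deg hs _) (hb m).1 (hb m).2
        (by simp [State.motion, hne])
      rw [Function.iterate_succ_apply']
      simpa [State.update, State.motion, hne, Motion.walk, Motion.isGo] using this
  set x := (L.step false)^[n] (v₀, 3)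
  obtain ⟨h3, h4⟩ := iterate_from_corner (L := L) hs h1 x.2
  have hb' := iterate_bounds (L := L) (x := x) hs (hb n).1 (hb n).2
  -- From the first corner on, `count` is the number of steps along the side. A zero count
  -- distinguishes that corner from the next one.
  have measure : ∀ m ≤ s - 1, E.Ready (n + m) i ((L.step false)^[m] x).1
      ⟨[], n + m, m, ((L.step false)^[m] x).2, ∅, ∅, ∅, ∅, ∅, none⟩ := by
    intro m
    induction m with
    | zero => intro _; exact seek n le_rfl
    | succ m ih =>
      intro hm
      have hne : ¬ (deg (grid s) ((L.step false)^[m] x).1 = 2 ∧ m ≠ 0) := by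
        rintro ⟨h, h'⟩
        exact h4 m (by omega) (by omega) h
      have hne' : ¬ (deg (grid s) ((L.step false)^[m] x).1 ≠ 2 ∧ m = 0) := by
        rintro ⟨h, rfl⟩
        exact h h1
      have := (ih (by omega)).walk hE hi (c := false) (two_le_deg hs _) (hb' m).1 (hb' m).2
        (by simp only [State.motion]; rw [if_neg hne])
      rw [Function.iterate_succ_apply']
      simp only [State.update, State.motion] at this
      rw [if_neg hne, if_neg hne, if_neg hne'] at this
      simpa [Motion.walk, Motion.isGo, ← add_assoc] using this
  have hlast := measure (s - 1) le_rfl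
  have hlast' := (hlast.stay hE hi (by
    simp only [State.motion]; rw [if_pos ⟨h3, by omega⟩])).2
  have hs0 : s - 1 ≠ 0 := by omega
  -- The subtraction is not truncated, because `n ≤ 2 * (s - 1)`.
  have h5 := ready_wait hE hi (3 * s - (n + (s - 1) + 1)) (l := program s) hlast' (by
    simp [State.update, h3, hs0, show s - 1 + 1 = s by omega])
  rw [show n + (s - 1) + 1 + (3 * s - (n + (s - 1) + 1)) = 3 * s by omega] at h5
  refine ⟨_, _, h5, h3, rfl, by simp [State.update, h3, hs0], ?_⟩
  simpa [State.update, State.motion, h3, hs0, Motion.isGo] using hb' (s - 1)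

/-- The centre of an odd grid is fixed by all symmetries, so robots with different frames meet
there. -/
theorem pt_centre [NeZero s] {m : ℕ} (hm : s = 2 * m + 1) (F F' : Frame) :
    pt s F m m = pt s F' m m := by
  rw [eq_pt_iff F' _ (by omega) (by omega), pt_fst_val _ (by omega) (by omega),
    pt_snd_val _ (by omega) (by omega)]
  simp only [reflect, ite_self]
  constructor <;> split <;> split <;> omega

/-- The macro round in which the dispersion begins. -/
def startTime (s : ℕ) : ℕ := 3 * s + (gatherProgram s).length

/-- For odd `s`, each robot goes to the middle of a side and straight in to the centre. Resetting
the back port to 3 erases its origin, and from then on the walk is the same for all. -/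
theorem ready_dispersion [NeZero s] (hs : 2 ≤ s) (hL : L.Oriented)
    (hE : E.IsExecution robotAlgorithm L ident B) :
    ∃ u : R → Fin s × Fin s, (s % 2 = 1 → ∀ i j, i ∉ B → j ∉ B → u i = u j) ∧
      ∀ i, i ∉ B → ∃ σ, E.Ready (startTime s) i (u i) σ ∧ deg (grid s) (u i) = 2 ∧
        σ.todo = dispersionProgram s ∧ σ.slot = none := by
  rcases Nat.mod_two_eq_zero_or_one s with hpar | hpar
  · have h : ∀ i, ∃ v, i ∉ B → ∃ σ, E.Ready (startTime s) i v σ ∧ deg (grid s) v = 2 ∧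
        σ.todo = dispersionProgram s ∧ σ.slot = none := by
      intro i
      by_cases hi : i ∈ B
      · exact ⟨default, fun h => absurd hi h⟩
      · obtain ⟨v, σ, h1, h2, h3, h4, -⟩ := ready_program hs hL hE hi
        refine ⟨v, fun _ => ⟨σ, ?_, h2, ?_, h4⟩⟩
        · simpa [startTime, gatherProgram, hpar] using h1
        · simpa [program, gatherProgram, hpar] using h3
    choose u hu using h
    exact ⟨u, by omega, hu⟩
  · obtain ⟨m, hm⟩ : ∃ m, s = 2 * m + 1 := ⟨s / 2, by omega⟩
    have hdiv : s / 2 = m := by omega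
    set c := pt s ⟨false, false, false⟩ m m with hc
    have hfin := deg_iterate_seekStep hs hL c (b := 3) (by omega) (by omega)
      (k := 2 * s) (by omega)
    refine ⟨fun _ => ((L.seekStep)^[2 * s] (c, 3)).1, fun _ _ _ _ _ => rfl, fun i hi => ?_⟩
    obtain ⟨v, σ, h1, h2, h3, h4, hb, hb'⟩ := ready_program hs hL hE hi
    have hprog : program s = List.replicate m .advance ++ (.turn ::
        (List.replicate (m - 1) .advance ++ .setBack 3 ::
          (List.replicate (2 * s) .seek ++ dispersionProgram s))) := by
      simp [program, gatherProgram, hpar, hdiv]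
    rw [hprog] at h3
    obtain ⟨F, rfl, hF⟩ := exists_step_corner (L := L) hs h2 σ.back false
    have a1 := ready_advance hs hE hi m h1 h3 h4 hb hb'
    have e1 := iterate_side hs (i := 0) hF (m - 1) (by omega)
    rw [show m - 1 + 1 = m by omega, show 0 + 1 + (m - 1) = m by omega, zero_add] at e1
    rw [e1] at a1
    have hside := step_side (L := L) hs F (i := m) (by omega) (by omega) true
    have bd := fun (c : Bool) (x y : Fin s × Fin s) (h : (grid s).Adj x y) =>
      (⟨(L.port_mem h).1, (L.port_mem h).2.trans (deg_le_four x)⟩ :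
        1 ≤ L.port x y ∧ L.port x y ≤ 4)
    have bd1 := bd true (pt s F m 0) (pt s F (m - 1) 0) (by rw [pt_adj_iff] <;> omega)
    have a2 := a1.walk hE hi (c := true) (two_le_deg hs _) bd1.1 bd1.2 (by simp [State.motion])
    have hside' : L.step true ((L.arrive (pt s F m 0) (pt s F (m - 1) 0)).1,
        (L.arrive (pt s F m 0) (pt s F (m - 1) 0)).2) =
          L.arrive (pt s F m 1) (pt s F m 0) := by simpa using hside
    simp only at a2
    rw [hside'] at a2
    have bd2 := bd true (pt s F m 1) (pt s F m 0) (by rw [pt_adj_iff] <;> omega)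
    have a3 := ready_advance hs hE hi (m - 1) a2 (by simp [State.update]; rfl)
      (by simpa [State.update] using h4)
      (by simpa [State.update, State.motion, Motion.walk, Motion.isGo, PortLabeling.arrive]
        using bd2.1)
      (by simpa [State.update, State.motion, Motion.walk, Motion.isGo, PortLabeling.arrive]
        using bd2.2)
    have e3 := iterate_line hL (F := F) (i := m) (j := 0) (by omega) (by omega) (m - 1)
      (by omega)
    rw [show 0 + 1 + (m - 1) = m by omega, show 0 + (m - 1) = m - 1 by omega] at e3
    simp only [State.update, State.motion, Motion.walk, Motion.isGo, if_true] at a3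
    have e3' : (L.step false)^[m - 1] ((L.arrive (pt s F m 1) (pt s F m 0)).1,
        (L.arrive (pt s F m 1) (pt s F m 0)).2) = L.arrive (pt s F m m) (pt s F m (m - 1)) := e3
    rw [e3'] at a3
    have a4 := (a3.stay hE hi (by simp [State.motion])).2
    have a5 := ready_seek hs hE hi (2 * s) (l := dispersionProgram s) a4
      (by simp [State.update]) (by simp [State.update]) (by simp [State.update])
    have hcen : (L.arrive (pt s F m m) (pt s F m (m - 1))).1 = c := pt_centre hm F _
    rw [hcen] at a5
    simp only [State.update] at a5
    have ht : startTime s = 3 * s + m + 1 + (m - 1) + 1 + 2 * s := by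
      simp [startTime, gatherProgram, hpar, hdiv]; omega
    rw [← ht] at a5
    exact ⟨_, a5, hfin.1, rfl, h4⟩

end Phases

/-! ### Announcing and choosing slots -/

theorem mem_record {base P : Finset ℕ} {w : ℕ} {r : Finset (ℕ × ℕ)} {x k : ℕ} :
    (x, k) ∈ record base P w r ↔
      (x, k) ∈ r ∨ (k = w ∧ x ∈ base ∧ x ∉ P ∧ ∀ k', (x, k') ∉ r) := by
  simp only [record, Finset.mem_union, Finset.mem_image, Finset.mem_filter, Finset.mem_sdiff,
    Prod.mk.injEq, Prod.exists, exists_and_right, exists_eq_right, not_exists]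
  constructor
  · rintro (h | ⟨y, ⟨⟨h1, h2⟩, h3⟩, rfl, rfl⟩)
    · exact Or.inl h
    · exact Or.inr ⟨rfl, h1, h2, h3⟩
  · rintro (h | ⟨rfl, h1, h2, h3⟩)
    · exact Or.inl h
    · exact Or.inr ⟨x, ⟨⟨h1, h2⟩, h3⟩, rfl, rfl⟩

/-- The record of the first absences of the elements of `base`. -/
def firstAbsences (base : Finset ℕ) (P : ℕ → Finset ℕ) : ℕ → Finset (ℕ × ℕ)
  | 0 => ∅
  | k + 1 => record base (P k) k (firstAbsences base P k)

theorem mem_firstAbsences {base : Finset ℕ} {P : ℕ → Finset ℕ} {k x r : ℕ} :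
    (x, r) ∈ firstAbsences base P k ↔ r < k ∧ x ∈ base ∧ x ∉ P r ∧ ∀ r' < r, x ∈ P r' := by
  induction k generalizing r with
  | zero => simp [firstAbsences]
  | succ k ih =>
    rw [firstAbsences, mem_record, ih]
    constructor
    · rintro (⟨h1, h2⟩ | ⟨rfl, h2, h3, h4⟩)
      · exact ⟨by omega, h2⟩
      · refine ⟨by omega, h2, h3, fun r' => ?_⟩
        induction r' using Nat.strong_induction_on with
        | _ r' ihr =>
          intro hr'
          by_contra hx
          exact h4 r' (ih.2 ⟨hr', h2, hx, fun r'' h => ihr r'' h (by omega)⟩)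
    · rintro ⟨h1, h2, h3, h4⟩
      by_cases hr : r < k
      · exact Or.inl ⟨hr, h2, h3, h4⟩
      · obtain rfl : r = k := by omega
        exact Or.inr ⟨rfl, h2, h3, fun k' hk' => (ih.1 hk').2.2.1 (h4 _ (ih.1 hk').1)⟩

/-- Since later absences are disregarded, even a Byzantine robot announces at most one row and one
column. -/
theorem firstAbsences_functional {base : Finset ℕ} {P : ℕ → Finset ℕ} {k x r r' : ℕ}
    (h : (x, r) ∈ firstAbsences base P k) (h' : (x, r') ∈ firstAbsences base P k) : r = r' := by
  rw [mem_firstAbsences] at h h'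
  obtain ⟨-, -, h1, h2⟩ := h
  obtain ⟨-, -, h3, h4⟩ := h'
  rcases lt_trichotomy r r' with hr | hr | hr
  · exact absurd (h4 _ hr) h1
  · exact hr
  · exact absurd (h2 _ hr) h3

theorem mem_freeSlots {h : ℕ} {rows cols : Finset (ℕ × ℕ)} {p : ℕ × ℕ} :
    p ∈ freeSlots h rows cols ↔
      (p.1 < h ∧ p.2 < h) ∧ ∀ x, (x, p.1) ∈ rows → (x, p.2) ∉ cols := by
  simp only [freeSlots, Finset.mem_toList, Finset.mem_filter, Finset.mem_product, Finset.mem_range,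
    Finset.mem_image, Prod.exists, exists_and_right, exists_eq_right, not_exists, not_and]
  refine and_congr_right fun _ => forall_congr' fun x => ?_
  constructor
  · intro h h1 h2; exact h ⟨_, h1⟩ h1 h2
  · intro h _ h1 h2; exact h h1 h2

theorem nodup_freeSlots (h : ℕ) (rows cols : Finset (ℕ × ℕ)) : (freeSlots h rows cols).Nodup :=
  Finset.nodup_toList _

theorem length_freeSlots_empty (h : ℕ) : (freeSlots h ∅ ∅).length = h ^ 2 := by
  simp [freeSlots, sq]

/-- Each occupied slot is assigned an identifier that announces it. As the tables are functional,
the identifier determines the slot, so the assignment is injective. -/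
theorem le_length_freeSlots (h : ℕ) {rows cols : Finset (ℕ × ℕ)}
    (hr : ∀ x r r', (x, r) ∈ rows → (x, r') ∈ rows → r = r')
    (hc : ∀ x r r', (x, r) ∈ cols → (x, r') ∈ cols → r = r') :
    h ^ 2 ≤ (freeSlots h rows cols).length + (rows.image Prod.fst).card := by
  have h1 : ((Finset.range h ×ˢ Finset.range h).filter fun p =>
      ∃ x ∈ rows.image Prod.fst, (x, p.1) ∈ rows ∧ (x, p.2) ∈ cols).card ≤
        (rows.image Prod.fst).card := by
    have : ∀ p : ℕ × ℕ, ∃ x, (∃ x ∈ rows.image Prod.fst, (x, p.1) ∈ rows ∧ (x, p.2) ∈ cols) →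
        x ∈ rows.image Prod.fst ∧ (x, p.1) ∈ rows ∧ (x, p.2) ∈ cols := by
      intro p
      by_cases hp : ∃ x ∈ rows.image Prod.fst, (x, p.1) ∈ rows ∧ (x, p.2) ∈ cols
      · obtain ⟨x, hx⟩ := hp
        exact ⟨x, fun _ => hx⟩
      · exact ⟨0, fun h => absurd h hp⟩
    choose g hg using this
    refine Finset.card_le_card_of_injOn g (fun p hp => ?_) (fun p hp p' hp' e => ?_)
    · exact (hg p (Finset.mem_filter.1 hp).2).1
    · have a := hg p (Finset.mem_filter.1 hp).2
      have a' := hg p' (Finset.mem_filter.1 hp').2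
      rw [e] at a
      exact Prod.ext (hr _ _ _ a.2.1 a'.2.1) (hc _ _ _ a.2.2 a'.2.2)
  have h2 := Finset.card_filter_add_card_filter_not (s := Finset.range h ×ˢ Finset.range h)
    (fun p => ∃ x ∈ rows.image Prod.fst, (x, p.1) ∈ rows ∧ (x, p.2) ∈ cols)
  rw [Finset.card_product, Finset.card_range] at h2
  simp only [freeSlots, Finset.length_toList]
  rw [sq]
  omega

/-! ### Ranks in a finite set -/

theorem rank_lt_card {S : Finset ℕ} {x : ℕ} (h : x ∈ S) : rank S x < S.card :=
  Finset.card_lt_card ⟨Finset.filter_subset _ _, fun h' => by simpa using h' h⟩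

theorem rank_lt_rank {S : Finset ℕ} {x y : ℕ} (hx : x ∈ S) (h : x < y) : rank S x < rank S y := by
  refine Finset.card_lt_card ⟨fun z hz => ?_, fun h' => ?_⟩
  · simp only [Finset.mem_filter] at hz ⊢
    exact ⟨hz.1, by omega⟩
  · have := h' (Finset.mem_filter.2 ⟨hx, h⟩)
    simp at this

theorem rank_injOn (S : Finset ℕ) : Set.InjOn (rank S) S := by
  intro x hx y hy h
  rcases lt_trichotomy x y with h' | h' | h'
  · exact absurd h (rank_lt_rank hx h').ne
  · exact h'
  · exact absurd h (rank_lt_rank hy h').ne'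

/-- The rank is a bijection from `S` onto the numbers below `S.card`. -/
theorem card_filter_rank (S : Finset ℕ) (k : ℕ) :
    (S.filter fun y => k ≤ rank S y).card = S.card - k := by
  have himage : S.image (rank S) = Finset.range S.card := by
    apply Finset.eq_of_subset_of_card_le
    · intro r hr
      obtain ⟨x, hx, rfl⟩ := Finset.mem_image.1 hr
      exact Finset.mem_range.2 (rank_lt_card hx)
    · rw [Finset.card_image_of_injOn (rank_injOn S), Finset.card_range]
  have h1 : (S.filter fun y => k ≤ rank S y).image (rank S) =
      (Finset.range S.card).filter (k ≤ ·) := by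
    rw [← himage, Finset.filter_image]
  have h2 := Finset.card_image_of_injOn
    ((rank_injOn S).mono (Finset.coe_subset.2 (Finset.filter_subset (fun y => k ≤ rank S y) S)))
  rw [← h2, h1]
  have : (Finset.range S.card).filter (k ≤ ·) = Finset.Ico k S.card := by
    ext; simp [and_comm]
  rw [this, Nat.card_Ico]

/-! ### Announcing and listening as sequences of instructions -/

section Choose

variable {V R : Type} [Fintype R] {G : SimpleGraph V} {E : History V R} {L : PortLabeling G}
  {ident : R → ℕ} {B : Finset R}

/-- Exactly one tick is a blink, the one whose number is the coordinate announced; during all others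
the robot is at home. -/
theorem ready_ticks_settled (hE : E.IsExecution robotAlgorithm L ident B) {i : R} (hi : i ∉ B)
    {v : V} (hv : 1 ≤ deg G v) {c : Bool} (k : ℕ) {l : List Instr} {τ : ℕ} {σ : State}
    {p : ℕ × ℕ} (h : E.Ready τ i v σ) (hl : σ.todo = (List.range k).map (.tick c) ++ l)
    (hσ : σ.slot = some p) :
    E.Ready (τ + k) i v { σ with todo := l } ∧ ∀ w < k,
      ((E.state (4 * (τ + w) + 1) i).pos = v ↔ w ≠ if c then p.2 else p.1) := by
  induction k generalizing l with
  | zero => obtain ⟨⟩ := σ; simp at hl; subst hl; exact ⟨h, by omega⟩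
  | succ k ih =>
    rw [List.range_succ, List.map_append, List.append_assoc] at hl
    obtain ⟨h1, h2⟩ := ih hl
    by_cases hk : k = if c then p.2 else p.1
    · obtain ⟨h3, h4⟩ := h1.blink hE hi hv (by simp [State.motion, hσ, hk])
      refine ⟨by simpa [State.update, State.motion, hσ, ← hk, Motion.isGo, add_assoc] using h4,
        fun w hw => ?_⟩
      by_cases hwk : w = k
      · subst hwk; simp [h3, ← hk]
      · exact h2 w (by omega)
    · obtain ⟨h3, h4⟩ := h1.stay hE hi (by simp [State.motion, hσ, hk])
      refine ⟨by simpa [State.update, State.motion, hσ, hk, Motion.isGo, add_assoc] using h4,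
        fun w hw => ?_⟩
      by_cases hwk : w = k
      · subst hwk; simp [h3, hk]
      · exact h2 w (by omega)

/-- The robots with a slot announce it. -/
theorem ready_choose_settled (hE : E.IsExecution robotAlgorithm L ident B) {i : R} (hi : i ∉ B)
    {v : V} (hv : 1 ≤ deg G v) {q h : ℕ} {l : List Instr} {τ : ℕ} {σ : State} {p : ℕ × ℕ}
    (hr : E.Ready τ i v σ) (hl : σ.todo = chooseProgram q h ++ l) (hσ : σ.slot = some p) :
    E.Ready (τ + (2 * h + 2)) i v { σ with todo := l } ∧ (E.state (4 * τ + 1) i).pos = v ∧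
      (∀ w < h, ((E.state (4 * (τ + 1 + w) + 1) i).pos = v ↔ w ≠ p.1)) ∧
      ∀ w < h, ((E.state (4 * (τ + 1 + h + w) + 1) i).pos = v ↔ w ≠ p.2) := by
  simp only [chooseProgram, List.cons_append, List.append_assoc] at hl
  obtain ⟨h1, h2⟩ := hr.stay hE hi (by simp [State.motion, hl])
  obtain ⟨h3, h4⟩ := ready_ticks_settled hE hi hv h h2 (by simp [State.update, hl, hσ]; rfl)
    (by simp [State.update, hl, hσ]; rfl)
  obtain ⟨h5, h6⟩ := ready_ticks_settled hE hi hv h h3 rfl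
    (by simp [State.update, hl, hσ]; rfl)
  have h7 := (h5.stay hE hi (by simp [State.motion])).2
  refine ⟨?_, h1, by simpa using h4, by simpa using h6⟩
  rw [show τ + (2 * h + 2) = τ + 1 + h + h + 1 by ring]
  simpa [State.update, State.motion, Motion.isGo, hl, hσ] using h7

theorem ready_ticks_rows (hE : E.IsExecution robotAlgorithm L ident B) {i : R} (hi : i ∉ B)
    {v : V} (k : ℕ) {l : List Instr} {τ : ℕ} {σ : State}
    (h : E.Ready τ i v σ) (hl : σ.todo = (List.range k).map (.tick false) ++ l)
    (hσ : σ.slot = none) (h0 : σ.rows = ∅) :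
    E.Ready (τ + k) i v { σ with
      todo := l
      rows := firstAbsences σ.base (fun w => E.crowd ident (4 * (τ + w) + 1) v) k } ∧
        ∀ w < k, (E.state (4 * (τ + w) + 1) i).pos = v := by
  induction k generalizing l with
  | zero =>
    obtain ⟨⟩ := σ
    simp at hl h0
    subst hl h0
    exact ⟨h, by omega⟩
  | succ k ih =>
    rw [List.range_succ, List.map_append, List.append_assoc] at hl
    obtain ⟨h1, h2⟩ := ih hl
    obtain ⟨h3, h4⟩ := h1.stay hE hi (by simp [State.motion, hσ])
    refine ⟨by simpa [State.update, State.motion, hσ, Motion.isGo, add_assoc,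
      firstAbsences] using h4, fun w hw => ?_⟩
    by_cases hwk : w = k
    · subst hwk; exact h3
    · exact h2 w (by omega)

theorem ready_ticks_cols (hE : E.IsExecution robotAlgorithm L ident B) {i : R} (hi : i ∉ B)
    {v : V} (k : ℕ) {l : List Instr} {τ : ℕ} {σ : State}
    (h : E.Ready τ i v σ) (hl : σ.todo = (List.range k).map (.tick true) ++ l)
    (hσ : σ.slot = none) (h0 : σ.cols = ∅) :
    E.Ready (τ + k) i v { σ with
      todo := l
      cols := firstAbsences σ.base (fun w => E.crowd ident (4 * (τ + w) + 1) v) k } ∧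
        ∀ w < k, (E.state (4 * (τ + w) + 1) i).pos = v := by
  induction k generalizing l with
  | zero =>
    obtain ⟨⟩ := σ
    simp at hl h0
    subst hl h0
    exact ⟨h, by omega⟩
  | succ k ih =>
    rw [List.range_succ, List.map_append, List.append_assoc] at hl
    obtain ⟨h1, h2⟩ := ih hl
    obtain ⟨h3, h4⟩ := h1.stay hE hi (by simp [State.motion, hσ])
    refine ⟨by simpa [State.update, State.motion, hσ, Motion.isGo, add_assoc,
      firstAbsences] using h4, fun w hw => ?_⟩
    by_cases hwk : w = k
    · subst hwk; exact h3
    · exact h2 w (by omega)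

/-- The rows recorded at the node `v` by a robot that ignores the identifiers in `K` and begins to
listen in macro round `τ`. -/
noncomputable def History.rowsHeard (E : History V R) (ident : R → ℕ) (τ h : ℕ) (v : V)
    (K : Finset ℕ) : Finset (ℕ × ℕ) :=
  firstAbsences (E.crowd ident (4 * τ + 1) v \ K)
    (fun w => E.crowd ident (4 * (τ + 1 + w) + 1) v) h

noncomputable def History.colsHeard (E : History V R) (ident : R → ℕ) (τ h : ℕ) (v : V)
    (K : Finset ℕ) : Finset (ℕ × ℕ) :=
  firstAbsences (E.crowd ident (4 * τ + 1) v \ K)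
    (fun w => E.crowd ident (4 * (τ + 1 + h + w) + 1) v) h

/-- The state of a robot without a slot when it may choose. -/
noncomputable def History.heard (E : History V R) (ident : R → ℕ) (τ h : ℕ) (v : V)
    (σ : State) : State :=
  { σ with
    base := E.crowd ident (4 * τ + 1) v \ σ.known
    rows := E.rowsHeard ident τ h v σ.known
    cols := E.colsHeard ident τ h v σ.known }

/-- The robots without a slot listen, and choose if they have come by port `q`. -/
theorem ready_choose_mobile (hE : E.IsExecution robotAlgorithm L ident B) {i : R} (hi : i ∉ B)
    {v : V} {q h : ℕ} {l : List Instr} {τ : ℕ} {σ : State}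
    (hr : E.Ready τ i v σ) (hl : σ.todo = chooseProgram q h ++ l) (hσ : σ.slot = none) :
    (∃ P, E.Ready (τ + (2 * h + 2)) i v
      (State.update (ident i) { E.heard ident τ h v σ with todo := .settle q h :: l }
        (deg G v) 0 P)) ∧ (E.state (4 * τ + 1) i).pos = v ∧
      (∀ w < h, (E.state (4 * (τ + 1 + w) + 1) i).pos = v) ∧
      ∀ w < h, (E.state (4 * (τ + 1 + h + w) + 1) i).pos = v := by
  simp only [chooseProgram, List.cons_append, List.append_assoc] at hl
  obtain ⟨h1, h2⟩ := hr.stay hE hi (by simp [State.motion, hl])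
  obtain ⟨h3, h4⟩ := ready_ticks_rows hE hi h h2 (by simp [State.update, hl, hσ]; rfl)
    (by simp [State.update, hl, hσ]) (by simp [State.update, hl, hσ])
  obtain ⟨h5, h6⟩ := ready_ticks_cols hE hi h h3 rfl
    (by simp [State.update, hl, hσ]) (by simp [State.update, hl, hσ])
  have h7 := (h5.stay hE hi (by simp [State.motion])).2
  refine ⟨⟨E.crowd ident (4 * (τ + 1 + h + h) + 1) v, ?_⟩, h1, by simpa using h4, by simpa using h6⟩
  rw [show τ + (2 * h + 2) = τ + 1 + h + h + 1 by ring]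
  convert h7 using 2
  simp [State.update, State.motion, Motion.isGo, hl, hσ, History.heard, History.rowsHeard,
    History.colsHeard]

end Choose

/-! ### The groups visit the corners -/

theorem Frame.rot_injective : Function.Injective Frame.rot := by
  rintro ⟨_ | _, _ | _, _ | _⟩ ⟨_ | _, _ | _, _ | _⟩ <;> simp [Frame.rot]

/-- A group visits four different corners, so no settled robot is met a second time. -/
theorem rot_corner_ne {s : ℕ} [NeZero s] (hs : 2 ≤ s) (F : Frame) {m k : ℕ} (hm : m < k)
    (hk : k ≤ 3) : pt s (Frame.rot^[m] F) 0 0 ≠ pt s (Frame.rot^[k] F) 0 0 := by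
  have h0 : (0 : ℕ) < s := by omega
  have h1 : s - 1 ≠ 0 := by omega
  intro h
  rw [eq_pt_iff _ _ h0 h0, pt_fst_val _ h0 h0, pt_snd_val _ h0 h0] at h
  obtain ⟨_ | _, _ | _, _ | _⟩ := F <;> interval_cases k <;> interval_cases m <;>
    simp [Frame.rot, reflect] at h <;> omega

/-- The number of corners at which a robot has been able to choose, if it has come by port `b`,
when the choices by the ports up to `q` have been made at the `k`-th corner. -/
def chosen (k q b : ℕ) : ℕ := if b ≤ q then k + 1 else k

section Crowds

variable {V R : Type} [Fintype R] {G : SimpleGraph V} {E : History V R} {L : PortLabeling G}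
  {ident : R → ℕ} {B : Finset R}

theorem mem_crowd_iff (hE : E.IsExecution robotAlgorithm L ident B)
    (hident : Function.Injective ident) {t : ℕ} {v : V} {j : R} (hj : j ∉ B) :
    ident j ∈ E.crowd ident t v ↔ (E.state t j).pos = v := by
  rw [mem_crowd]
  constructor
  · rintro ⟨i, -, h, e⟩
    rwa [← hident e]
  · intro h
    exact ⟨j, hE.present t j hj, h, rfl⟩

theorem crowd_subset {t : ℕ} {v : V} :
    E.crowd ident t v ⊆ Finset.univ.image ident := by
  intro x hx
  obtain ⟨j, -, -, rfl⟩ := mem_crowd.1 hx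
  exact Finset.mem_image_of_mem _ (Finset.mem_univ _)

theorem rowsHeard_fst {τ h : ℕ} {v : V} {K : Finset ℕ} :
    (E.rowsHeard ident τ h v K).image Prod.fst ⊆ E.crowd ident (4 * τ + 1) v \ K := by
  intro x hx
  obtain ⟨⟨y, r⟩, hy, rfl⟩ := Finset.mem_image.1 hx
  exact (mem_firstAbsences.1 hy).2.1

end Crowds

section Groups

variable {s : ℕ} [NeZero s] {R : Type} [Fintype R] {E : History (Fin s × Fin s) R}
  {L : PortLabeling (grid s)} {ident : R → ℕ} {B : Finset R}

/-- The situation at the beginning of macro round `τ`, in which the robots without a slot have come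
to the `k`-th corner, those of them that have come by a port up to `q` have chosen, and the
instructions `l` are left. `F i` is the coordinate system in which the robot `i` starts, and robots
with the same coordinate system form a group. -/
structure Arrangement (E : History (Fin s × Fin s) R) (L : PortLabeling (grid s)) (ident : R → ℕ)
    (B : Finset R) (F : R → Frame) (h τ k q : ℕ) (l : List Instr) (u : R → Fin s × Fin s)
    (S : R → State) : Prop where
  ready : ∀ i, i ∉ B → E.Ready τ i (u i) (S i)
  todo : ∀ i, i ∉ B → (S i).todo = l
  corner : ∀ i, i ∉ B → deg (grid s) (u i) = 2
  slot_lt : ∀ i, i ∉ B → ∀ p, (S i).slot = some p → p.1 < h ∧ p.2 < h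
  mobile : ∀ i, i ∉ B → (S i).slot = none →
    (u i, (S i).back) = L.arrive (pt s (Frame.rot^[k] (F i)) 0 0) (pt s (Frame.rot^[k] (F i)) 0 1)
  mem_group : ∀ i, i ∉ B → (S i).slot = none → ident i ∈ (S i).group
  group_subset : ∀ i, i ∉ B → (S i).slot = none → (S i).group ⊆ (S i).known
  known_subset : ∀ i, i ∉ B → (S i).slot = none → (S i).known ⊆ Finset.univ.image ident
  -- The potential behind the counting: each choice that leaves the robot without a slot has charged
  -- `h ^ 2` known identifiers that no longer belong to the group.
  count : ∀ i, i ∉ B → (S i).slot = none →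
    chosen k q (S i).back * h ^ 2 + (S i).group.card ≤ (S i).known.card
  same : ∀ i j, i ∉ B → j ∉ B → (S i).slot = none → (S j).slot = none → F i = F j →
    (S i).known = (S j).known ∧ (S i).group = (S j).group
  distinct : ∀ i j p, i ∉ B → j ∉ B → i ≠ j → (S i).slot = some p → (S j).slot = some p →
    u i ≠ u j
  -- A group must not know honest unsettled robots of other groups, which might later settle at a
  -- corner that this group has yet to visit.
  known_mobile : ∀ i j, i ∉ B → j ∉ B → (S i).slot = none → (S j).slot = none →
    ident j ∈ (S i).known → F i = F j
  -- This makes it safe to ignore known identifiers at the corners still ahead.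
  known_settled : ∀ i j, i ∉ B → j ∉ B → (S i).slot = none → (S j).slot ≠ none →
    ident j ∈ (S i).known →
      ∃ m < chosen k q (S i).back, u j = pt s (Frame.rot^[m] (F i)) 0 0
  odd : s % 2 = 1 → ∀ i j, i ∉ B → j ∉ B → (S i).slot ≠ none ∧ u i = u j

variable {F : R → Frame} {h τ k q : ℕ} {l : List Instr} {u : R → Fin s × Fin s} {S : R → State}

theorem Arrangement.back_bounds (hs : 2 ≤ s) (A : Arrangement E L ident B F h τ k q l u S)
    {i : R} (hi : i ∉ B) (hσ : (S i).slot = none) : 1 ≤ (S i).back ∧ (S i).back ≤ 2 := by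
  have h1 := congrArg Prod.snd (A.mobile i hi hσ)
  have h2 := corner_ports hs L (Frame.rot^[k] (F i))
  simp only [PortLabeling.arrive] at h1
  rw [h1]
  exact ⟨h2.2.2.2.1, h2.2.2.2.2⟩

/-- All groups go to the next corner. -/
theorem Arrangement.advance (hs : 2 ≤ s) (hE : E.IsExecution robotAlgorithm L ident B)
    (A : Arrangement E L ident B F h τ k 2 (List.replicate (s - 1) .advance ++ l) u S) :
    ∃ u' S', Arrangement E L ident B F h (τ + (s - 1)) (k + 1) 0 l u' S' := by
  have key : ∀ i, ∃ v σ, i ∉ B → E.Ready (τ + (s - 1)) i v σ ∧ σ.todo = l ∧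
      deg (grid s) v = 2 ∧ σ.slot = (S i).slot ∧ σ.known = (S i).known ∧ σ.group = (S i).group ∧
      ((S i).slot = none → (v, σ.back) = L.arrive (pt s (Frame.rot^[k + 1] (F i)) 0 0)
        (pt s (Frame.rot^[k + 1] (F i)) 0 1)) ∧ ((S i).slot ≠ none → v = u i) := by
    intro i
    by_cases hi : i ∈ B
    · exact ⟨u i, S i, fun h => absurd hi h⟩
    by_cases hσ : (S i).slot = none
    · have hb := A.back_bounds hs hi hσ
      have := ready_advance hs hE hi (s - 1) (A.ready i hi) (A.todo i hi) hσ hb.1 (by omega)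
      rw [A.mobile i hi hσ, iterate_rot hs, ← Function.iterate_succ_apply' Frame.rot k] at this
      exact ⟨_, _, fun _ => ⟨this, rfl, deg_corner hs _, rfl, rfl, rfl, fun _ => rfl,
        fun h => absurd hσ h⟩⟩
    · exact ⟨_, _, fun _ => ⟨ready_advance_settled hE hi (s - 1) (A.ready i hi) (A.todo i hi) hσ,
        rfl, A.corner i hi, rfl, rfl, rfl, fun h => absurd h hσ, fun _ => rfl⟩⟩
  choose u' S' key using key
  have hslot := fun i hi => (key i hi).2.2.2.1
  have hknown := fun i hi => (key i hi).2.2.2.2.1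
  have hgroup := fun i hi => (key i hi).2.2.2.2.2.1
  have hmob := fun i hi => (key i hi).2.2.2.2.2.2.1
  have hset := fun i hi => (key i hi).2.2.2.2.2.2.2
  -- On arrival the entry port is at least 1, so nobody counts as having chosen at the new corner;
  -- before departure it was at most 2, so all had chosen at the old one.
  have hch : ∀ i, i ∉ B → (S i).slot = none →
      chosen (k + 1) 0 (S' i).back = chosen k 2 (S i).back := by
    intro i hi hσ
    have h1 := congrArg Prod.snd (hmob i hi hσ)
    have h2 := corner_ports hs L (Frame.rot^[k + 1] (F i))
    have h3 := A.back_bounds hs hi hσ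
    simp only [PortLabeling.arrive] at h1
    rw [chosen, chosen, if_pos h3.2, if_neg (by omega)]
  refine ⟨u', S', ⟨fun i hi => (key i hi).1, fun i hi => (key i hi).2.1,
    fun i hi => (key i hi).2.2.1, ?_, ?_, ?_, ?_, ?_, ?_, ?_, ?_, ?_, ?_, ?_⟩⟩
  · intro i hi; rw [hslot i hi]; exact A.slot_lt i hi
  · intro i hi; rw [hslot i hi]; exact hmob i hi
  · intro i hi; rw [hslot i hi, hgroup i hi]; exact A.mem_group i hi
  · intro i hi; rw [hslot i hi, hgroup i hi, hknown i hi]; exact A.group_subset i hi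
  · intro i hi; rw [hslot i hi, hknown i hi]; exact A.known_subset i hi
  · intro i hi hσ
    rw [hslot i hi] at hσ
    rw [hgroup i hi, hknown i hi, hch i hi hσ]
    exact A.count i hi hσ
  · intro i j hi hj
    rw [hslot i hi, hslot j hj, hknown i hi, hknown j hj, hgroup i hi, hgroup j hj]
    exact A.same i j hi hj
  · intro i j p hi hj
    rw [hslot i hi, hslot j hj]
    intro hij h1 h2
    rw [hset i hi (by simp [h1]), hset j hj (by simp [h2])]
    exact A.distinct i j p hi hj hij h1 h2
  · intro i j hi hj
    rw [hslot i hi, hslot j hj, hknown i hi]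
    exact A.known_mobile i j hi hj
  · intro i j hi hj
    rw [hslot i hi, hslot j hj, hknown i hi]
    intro h1 h2 h3
    rw [hch i hi h1, hset j hj h2]
    exact A.known_settled i j hi hj h1 h2 h3
  · intro hpar i j hi hj
    obtain ⟨h1, h2⟩ := A.odd hpar i j hi hj
    obtain ⟨h3, -⟩ := A.odd hpar j i hj hi
    rw [hslot i hi, hset i hi h1, hset j hj h3]
    exact ⟨h1, h2⟩

/-- The positions of the robots while the robots without a slot listen. -/
theorem Arrangement.positions (hE : E.IsExecution robotAlgorithm L ident B) {q' : ℕ}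
    (A : Arrangement E L ident B F h τ k q (chooseProgram q' h ++ l) u S) {j : R} (hj : j ∉ B) :
    (E.state (4 * τ + 1) j).pos = u j ∧
    ((S j).slot = none → ∀ w < h, (E.state (4 * (τ + 1 + w) + 1) j).pos = u j) ∧
    ∀ p, (S j).slot = some p →
      (∀ w < h, ((E.state (4 * (τ + 1 + w) + 1) j).pos = u j ↔ w ≠ p.1)) ∧
      ∀ w < h, ((E.state (4 * (τ + 1 + h + w) + 1) j).pos = u j ↔ w ≠ p.2) := by
  cases hσ : (S j).slot with
  | none =>
    obtain ⟨-, h1, h2, -⟩ := ready_choose_mobile hE hj (A.ready j hj) (A.todo j hj) hσ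
    exact ⟨h1, fun _ => h2, by simp⟩
  | some p =>
    obtain ⟨-, h1, h2⟩ := ready_choose_settled hE hj (by rw [A.corner j hj]; omega) (A.ready j hj)
      (A.todo j hj) hσ
    refine ⟨h1, by simp, ?_⟩
    rintro p' hp'
    obtain rfl := Option.some.inj hp'
    exact h2

/-- No robot without a slot is heard. -/
theorem Arrangement.not_heard (hE : E.IsExecution robotAlgorithm L ident B)
    (hident : Function.Injective ident) {q' : ℕ}
    (A : Arrangement E L ident B F h τ k q (chooseProgram q' h ++ l) u S) {j : R} (hj : j ∉ B)
    {v : Fin s × Fin s} {K : Finset ℕ}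
    (hmem : ident j ∈ (E.rowsHeard ident τ h v K).image Prod.fst) :
    (S j).slot ≠ none ∧ u j = v := by
  obtain ⟨⟨x, r⟩, hx, rfl⟩ := Finset.mem_image.1 hmem
  obtain ⟨h1, h2, h3, -⟩ := mem_firstAbsences.1 hx
  have h4 := (mem_crowd_iff hE hident hj).1 (Finset.mem_sdiff.1 h2).1
  obtain ⟨h5, h6, -⟩ := A.positions hE hj
  rw [h5] at h4
  refine ⟨fun hσ => h3 ((mem_crowd_iff hE hident hj).2 ?_), h4⟩
  rw [h6 hσ r h1, h4]

/-- The slot of a robot that is not known yet is heard. -/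
theorem Arrangement.slot_heard (hE : E.IsExecution robotAlgorithm L ident B)
    (hident : Function.Injective ident) {q' : ℕ}
    (A : Arrangement E L ident B F h τ k q (chooseProgram q' h ++ l) u S) {j : R} (hj : j ∉ B)
    {p : ℕ × ℕ} (hp : (S j).slot = some p) {K : Finset ℕ} (hK : ident j ∉ K) :
    p ∉ freeSlots h (E.rowsHeard ident τ h (u j) K) (E.colsHeard ident τ h (u j) K) := by
  obtain ⟨h1, -, h2⟩ := A.positions hE hj
  obtain ⟨h3, h4⟩ := h2 p hp
  obtain ⟨h5, h6⟩ := A.slot_lt j hj p hp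
  have hbase : ident j ∈ E.crowd ident (4 * τ + 1) (u j) \ K :=
    Finset.mem_sdiff.2 ⟨(mem_crowd_iff hE hident hj).2 h1, hK⟩
  intro hfree
  refine (mem_freeSlots.1 hfree).2 (ident j) (mem_firstAbsences.2 ⟨h5, hbase, ?_, ?_⟩)
    (mem_firstAbsences.2 ⟨h6, hbase, ?_, ?_⟩)
  · rw [mem_crowd_iff hE hident hj, h3 _ h5]; simp
  · intro r hr; rw [mem_crowd_iff hE hident hj, h3 _ (by omega)]; omega
  · rw [mem_crowd_iff hE hident hj, h4 _ h6]; simp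
  · intro r hr; rw [mem_crowd_iff hE hident hj, h4 _ (by omega)]; omega

/-- At a corner, the groups that have come by port `q + 1` choose. -/
theorem Arrangement.choose (hs : 2 ≤ s) (hE : E.IsExecution robotAlgorithm L ident B)
    (hident : Function.Injective ident) (hk : k ≤ 3)
    (A : Arrangement E L ident B F h τ k q (chooseProgram (q + 1) h ++ l) u S) :
    ∃ S', Arrangement E L ident B F h (τ + (2 * h + 2)) k (q + 1) l u S' := by
  set rows := fun i => E.rowsHeard ident τ h (u i) (S i).known with hrows
  set cols := fun i => E.colsHeard ident τ h (u i) (S i).known with hcols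
  set free := fun i => freeSlots h (rows i) (cols i) with hfree
  have key : ∀ i, ∃ σ : State, i ∉ B → E.Ready (τ + (2 * h + 2)) i (u i) σ ∧ σ.todo = l ∧
      σ.back = (S i).back ∧
      ((S i).slot ≠ none → σ.slot = (S i).slot) ∧
      ((S i).slot = none → (S i).back ≠ q + 1 → σ.slot = none ∧ σ.known = (S i).known ∧
        σ.group = (S i).group) ∧
      ((S i).slot = none → (S i).back = q + 1 →
        σ.slot = (free i)[rank (S i).group (ident i)]? ∧
        σ.known = (S i).known ∪ (rows i).image Prod.fst ∧
        σ.group = (S i).group.filter fun y => (free i).length ≤ rank (S i).group y) := by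
    intro i
    by_cases hi : i ∈ B
    · exact ⟨S i, fun h => absurd hi h⟩
    cases hσ : (S i).slot with
    | none =>
      obtain ⟨⟨P, h1⟩, -⟩ := ready_choose_mobile hE hi (A.ready i hi) (A.todo i hi) hσ
      refine ⟨_, fun _ => ⟨h1, ?_⟩⟩
      by_cases hb : (S i).back = q + 1
      · simp [State.update, History.heard, hσ, hb, State.motion, Motion.isGo, hfree, hrows, hcols]
      · simp [State.update, History.heard, hσ, hb, State.motion, Motion.isGo]
    | some p =>
      have h1 := ready_choose_settled hE hi (by rw [A.corner i hi]; omega) (A.ready i hi)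
        (A.todo i hi) hσ
      exact ⟨_, fun _ => ⟨h1.1, rfl, rfl, fun _ => hσ, by simp, by simp⟩⟩
  choose S' key using key
  have hback := fun i hi => (key i hi).2.2.1
  have hset := fun i hi => (key i hi).2.2.2.1
  have hpas := fun i hi => (key i hi).2.2.2.2.1
  have hact := fun i hi => (key i hi).2.2.2.2.2
  have hmob : ∀ i, i ∉ B → (S' i).slot = none → (S i).slot = none := by
    intro i hi hσ
    by_contra hne
    exact hne ((hset i hi hne).symm.trans hσ)
  have hsame : ∀ i j, i ∉ B → j ∉ B → (S i).slot = none → (S j).slot = none → F i = F j →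
      u i = u j ∧ (S i).back = (S j).back ∧ free i = free j ∧ rows i = rows j ∧
        (S i).known = (S j).known ∧ (S i).group = (S j).group := by
    intro i j hi hj h1 h2 hF
    obtain ⟨h3, h4⟩ := A.same i j hi hj h1 h2 hF
    have h5 := (A.mobile i hi h1).trans ((hF ▸ rfl : _ = _).trans (A.mobile j hj h2).symm)
    obtain ⟨h6, h7⟩ := Prod.mk.inj h5
    have h8 : rows i = rows j := by simp only [hrows, h6, h3]
    have h9 : cols i = cols j := by simp only [hcols, h6, h3]
    exact ⟨h6, h7, by simp only [hfree, h8, h9], h8, h3, h4⟩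
  -- A corner and an entry port determine the frame, and rotation is injective. Hence the robots
  -- that choose at the same time at one corner form a single group.
  have hframe : ∀ i j, i ∉ B → j ∉ B → (S i).slot = none → (S j).slot = none → u i = u j →
      (S i).back = (S j).back → F i = F j := by
    intro i j hi hj h1 h2 hu hb
    have h3 := A.mobile i hi h1
    rw [hu, hb, A.mobile j hj h2] at h3
    obtain ⟨h4, h5⟩ := Prod.mk.inj h3
    refine Frame.rot_injective.iterate k (frame_ext hs h4.symm ?_)
    have adj : ∀ G : Frame, (grid s).Adj (pt s G 0 0) (pt s G 0 1) := fun G => by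
      rw [pt_adj_iff] <;> omega
    rw [← h4] at h5
    exact (L.port_inj (adj _) (h4 ▸ adj _) h5).symm
  have hchosen : ∀ i, chosen k q (S i).back ≤ chosen k (q + 1) (S' i).back ∨ i ∈ B := by
    intro i
    by_cases hi : i ∈ B
    · exact Or.inr hi
    · left; rw [hback i hi, chosen, chosen]; split <;> split <;> omega
  have hnew : ∀ i, i ∉ B → (S' i).slot ≠ none → (S i).slot = none → (S i).back = q + 1 := by
    intro i hi h1 h2
    by_contra hb
    exact h1 (hpas i hi h2 hb).1
  have hnew_free : ∀ i, i ∉ B → ∀ p, (S' i).slot = some p → (S i).slot = none →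
      (free i)[rank (S i).group (ident i)]? = some p := by
    intro i hi p h1 h2
    rw [← h1, (hact i hi h2 (hnew i hi (by simp [h1]) h2)).1]
  have hcross : ∀ i j p, i ∉ B → j ∉ B → (S' i).slot = some p → (S i).slot = none →
      (S j).slot = some p → u i ≠ u j := by
    intro i j p hi hj h1 h2 h3 hu
    have h4 := List.mem_of_getElem? (hnew_free i hi p h1 h2)
    have hb := hnew i hi (by simp [h1]) h2
    -- A known settled robot sits at a corner visited earlier; an unknown one at this corner has
    -- been heard, so its slot is not free.
    by_cases hK : ident j ∈ (S i).known
    · obtain ⟨m, hm, e⟩ := A.known_settled i j hi hj h2 (by simp [h3]) hK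
      rw [chosen, if_neg (by omega)] at hm
      rw [← hu, (Prod.mk.inj (A.mobile i hi h2)).1] at e
      exact rot_corner_ne hs (F i) hm hk e.symm
    · refine A.slot_heard hE hident hj h3 hK ?_
      rw [← hu]
      exact h4
  refine ⟨S', ⟨fun i hi => (key i hi).1, fun i hi => (key i hi).2.1, A.corner,
    ?_, ?_, ?_, ?_, ?_, ?_, ?_, ?_, ?_, ?_, ?_⟩⟩
  · intro i hi p hp
    by_cases hσ : (S i).slot = none
    · exact (mem_freeSlots.1 (List.mem_of_getElem? (hnew_free i hi p hp hσ))).1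
    · exact A.slot_lt i hi p ((hset i hi hσ).symm.trans hp)
  · intro i hi hσ
    rw [hback i hi]
    exact A.mobile i hi (hmob i hi hσ)
  · intro i hi hσ
    have h0 := hmob i hi hσ
    by_cases hb : (S i).back = q + 1
    · obtain ⟨h1, -, h2⟩ := hact i hi h0 hb
      rw [h1, List.getElem?_eq_none_iff] at hσ
      rw [h2]
      exact Finset.mem_filter.2 ⟨A.mem_group i hi h0, hσ⟩
    · rw [(hpas i hi h0 hb).2.2]
      exact A.mem_group i hi h0
  · intro i hi hσ
    have h0 := hmob i hi hσ
    have h1 := A.group_subset i hi h0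
    by_cases hb : (S i).back = q + 1
    · rw [(hact i hi h0 hb).2.1, (hact i hi h0 hb).2.2]
      exact (Finset.filter_subset _ _).trans (h1.trans Finset.subset_union_left)
    · rw [(hpas i hi h0 hb).2.1, (hpas i hi h0 hb).2.2]
      exact h1
  · intro i hi hσ
    have h0 := hmob i hi hσ
    have h1 := A.known_subset i hi h0
    by_cases hb : (S i).back = q + 1
    · rw [(hact i hi h0 hb).2.1]
      exact Finset.union_subset h1
        (rowsHeard_fst.trans (Finset.sdiff_subset.trans crowd_subset))
    · rw [(hpas i hi h0 hb).2.1]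
      exact h1
  · intro i hi hσ
    have h0 := hmob i hi hσ
    have h1 := A.count i hi h0
    rw [hback i hi]
    by_cases hb : (S i).back = q + 1
    · obtain ⟨h2, h3, h4⟩ := hact i hi h0 hb
      rw [h2, List.getElem?_eq_none_iff] at hσ
      have h5 := rank_lt_card (A.mem_group i hi h0)
      have h6 : h ^ 2 ≤ (free i).length + ((rows i).image Prod.fst).card :=
        le_length_freeSlots h (fun _ _ _ => firstAbsences_functional)
          (fun _ _ _ => firstAbsences_functional)
      -- The identifiers heard are new, since listening excludes the known ones; their number is
      -- therefore added in full.
      have h7 : ((S i).known ∪ (rows i).image Prod.fst).card =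
          (S i).known.card + ((rows i).image Prod.fst).card := by
        refine Finset.card_union_of_disjoint (Finset.disjoint_right.2 fun x hx => ?_)
        exact (Finset.mem_sdiff.1 (rowsHeard_fst hx)).2
      rw [h3, h4, h7, card_filter_rank, hb, chosen, if_pos le_rfl]
      rw [hb, chosen, if_neg (by omega)] at h1
      rw [add_mul, one_mul]
      omega
    · obtain ⟨h2, h3, h4⟩ := hpas i hi h0 hb
      rw [h3, h4]
      have : chosen k (q + 1) (S i).back = chosen k q (S i).back := by
        rw [chosen, chosen]; split <;> split <;> omega
      rwa [this]
  · intro i j hi hj h1 h2 hF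
    have h3 := hmob i hi h1
    have h4 := hmob j hj h2
    obtain ⟨-, e2, e3, e4, e5, e6⟩ := hsame i j hi hj h3 h4 hF
    by_cases hb : (S i).back = q + 1
    · rw [(hact i hi h3 hb).2.1, (hact i hi h3 hb).2.2, (hact j hj h4 (e2 ▸ hb)).2.1,
        (hact j hj h4 (e2 ▸ hb)).2.2, e3, e4, e5, e6]
      exact ⟨rfl, rfl⟩
    · rw [(hpas i hi h3 hb).2.1, (hpas i hi h3 hb).2.2, (hpas j hj h4 (e2 ▸ hb)).2.1,
        (hpas j hj h4 (e2 ▸ hb)).2.2]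
      exact ⟨e5, e6⟩
  · intro i j p hi hj hij h1 h2 hu
    cases h3 : (S i).slot with
    | none =>
      cases h4 : (S j).slot with
      | none =>
        have b1 := hnew i hi (by simp [h1]) h3
        have b2 := hnew j hj (by simp [h2]) h4
        -- Two robots that have just chosen the same slot use the same duplicate-free list and the
        -- same group, so their ranks, hence their identifiers, agree.
        obtain ⟨-, -, e3, -, -, e6⟩ :=
          hsame i j hi hj h3 h4 (hframe i j hi hj h3 h4 hu (b1.trans b2.symm))
        have f1 := hnew_free i hi p h1 h3
        have f2 := hnew_free j hj p h2 h4
        rw [e3] at f1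
        have hlt := (List.getElem?_eq_some_iff.1 f1).1
        have e := (List.getElem?_inj hlt (nodup_freeSlots h (rows j) (cols j))).1
          (f1.trans f2.symm)
        rw [e6] at e
        have m1 := A.mem_group i hi h3
        rw [e6] at m1
        exact hij (hident (rank_injOn _ m1 (A.mem_group j hj h4) e))
      | some p' =>
        have h5 := hset j hj (by simp [h4])
        exact hcross i j p hi hj h1 h3 (h5.symm.trans h2) hu
    | some p' =>
      have h5 := (hset i hi (by simp [h3])).symm.trans h1
      cases h4 : (S j).slot with
      | none => exact hcross j i p hj hi h2 h4 h5 hu.symm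
      | some p'' =>
        exact A.distinct i j p hi hj hij h5 ((hset j hj (by simp [h4])).symm.trans h2) hu
  · intro i j hi hj h1 h2 hmem
    have h3 := hmob i hi h1
    have h4 := hmob j hj h2
    by_cases hb : (S i).back = q + 1
    · rw [(hact i hi h3 hb).2.1] at hmem
      rcases Finset.mem_union.1 hmem with hmem | hmem
      · exact A.known_mobile i j hi hj h3 h4 hmem
      · exact absurd h4 (A.not_heard hE hident hj hmem).1
    · rw [(hpas i hi h3 hb).2.1] at hmem
      exact A.known_mobile i j hi hj h3 h4 hmem
  · intro i j hi hj h1 h2 hmem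
    have h3 := hmob i hi h1
    have hle := (hchosen i).resolve_right hi
    have hu := (Prod.mk.inj (A.mobile i hi h3)).1
    -- A known robot that settles only now belongs to the same group, so it settles at the current
    -- corner in the same choice.
    have hold : ident j ∈ (S i).known → ∃ m < chosen k (q + 1) (S' i).back,
        u j = pt s (Frame.rot^[m] (F i)) 0 0 := by
      intro hmem
      by_cases h4 : (S j).slot = none
      · have hF := A.known_mobile i j hi hj h3 h4 hmem
        obtain ⟨e1, e2, -⟩ := hsame i j hi hj h3 h4 hF
        have hb := hnew j hj h2 h4
        refine ⟨k, ?_, by rw [← e1, hu]⟩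
        rw [hback i hi, e2, hb, chosen, if_pos le_rfl]
        omega
      · obtain ⟨m, hm, e⟩ := A.known_settled i j hi hj h3 h4 hmem
        exact ⟨m, by omega, e⟩
    by_cases hb : (S i).back = q + 1
    · rw [(hact i hi h3 hb).2.1] at hmem
      rcases Finset.mem_union.1 hmem with hmem | hmem
      · exact hold hmem
      · refine ⟨k, ?_, (A.not_heard hE hident hj hmem).2.trans hu⟩
        rw [hback i hi, hb, chosen, if_pos le_rfl]
        omega
    · rw [(hpas i hi h3 hb).2.1] at hmem
      exact hold hmem
  · intro hpar i j hi hj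
    obtain ⟨h1, h2⟩ := A.odd hpar i j hi hj
    rw [hset i hi h1]
    exact ⟨h1, h2⟩

end Groups

/-! ### The first and the last part of the dispersion -/

section Dispersion

variable {s : ℕ} [NeZero s] {R : Type} [Fintype R] {E : History (Fin s × Fin s) R}
  {L : PortLabeling (grid s)} {ident : R → ℕ} {B : Finset R}

/-- The initial choice needs no announcements: everyone at the corner takes part, all slots are
free, and the crowd itself is the known set. -/
theorem exists_arrangement (hs : 2 ≤ s) (hL : L.Oriented)
    (hE : E.IsExecution robotAlgorithm L ident B) (hident : Function.Injective ident)
    (hR : Fintype.card R ≤ s ^ 2) :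
    ∃ F u S, Arrangement E L ident B F (slotSide s) (startTime s + 3) 0 2
      (stageProgram s ++ (stageProgram s ++ (stageProgram s ++ approachProgram s))) u S := by
  obtain ⟨u, hodd, hu⟩ := ready_dispersion hs hL hE
  have hF : ∀ v, ∃ F, deg (grid s) v = 2 → v = pt s F 0 0 ∧
      L.port (pt s F 0 0) (pt s F 1 0) = 1 ∧ L.port (pt s F 0 0) (pt s F 0 1) = 2 := by
    intro v
    by_cases hv : deg (grid s) v = 2
    · obtain ⟨F, hF⟩ := exists_corner_frame hs L hv
      exact ⟨F, fun _ => hF⟩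
    · exact ⟨⟨false, false, false⟩, fun h => absurd h hv⟩
  choose F hF using hF
  set h := slotSide s with hh
  set l := stageProgram s ++ (stageProgram s ++ (stageProgram s ++ approachProgram s)) with hl
  set P := fun v => E.crowd ident (4 * (startTime s + 1) + 1) v with hP
  have key : ∀ i, ∃ σ : State, i ∉ B → E.Ready (startTime s + 3) i (u i) σ ∧ σ.todo = l ∧
      σ.back = 2 ∧ σ.known = P (u i) ∧
      σ.group = (P (u i)).filter (fun y => h ^ 2 ≤ rank (P (u i)) y) ∧
      σ.slot = (freeSlots h ∅ ∅)[rank (P (u i)) (ident i)]? ∧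
      (E.state (4 * (startTime s + 1) + 1) i).pos = u i := by
    intro i
    by_cases hi : i ∈ B
    · exact ⟨.initial, fun h => absurd hi h⟩
    obtain ⟨σ, h1, h2, h3, h4⟩ := hu i hi
    have a1 := (h1.stay hE hi (by simp [State.motion, h3, dispersionProgram])).2
    obtain ⟨p, a2⟩ := a1.stay hE hi (by
      simp [State.motion, State.update, h3, dispersionProgram])
    have a3 := (a2.stay hE hi (by
      simp [State.motion, State.update, h3, dispersionProgram])).2
    refine ⟨_, fun _ => ⟨a3, ?_⟩⟩
    simp [State.update, State.motion, Motion.isGo, h3, h4, dispersionProgram, hP, hh, hl, p,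
      length_freeSlots_empty]
  choose S key using key
  have hback := fun i hi => (key i hi).2.2.1
  have hknown := fun i hi => (key i hi).2.2.2.1
  have hgroup := fun i hi => (key i hi).2.2.2.2.1
  have hslot := fun i hi => (key i hi).2.2.2.2.2.1
  have hpos := fun i hi => (key i hi).2.2.2.2.2.2
  have hdeg : ∀ i, i ∉ B → deg (grid s) (u i) = 2 := fun i hi => (hu i hi).choose_spec.2.1
  have hmem : ∀ i, i ∉ B → ident i ∈ P (u i) := fun i hi =>
    (mem_crowd_iff hE hident hi).2 (hpos i hi)
  have hnone : ∀ i, i ∉ B → (S i).slot = none → h ^ 2 ≤ rank (P (u i)) (ident i) := by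
    intro i hi h1
    rwa [hslot i hi, List.getElem?_eq_none_iff, length_freeSlots_empty] at h1
  have hframe : ∀ i j, i ∉ B → j ∉ B → F (u i) = F (u j) → u i = u j := by
    intro i j hi hj e
    rw [(hF _ (hdeg i hi)).1, e, ← (hF _ (hdeg j hj)).1]
  have hcard : ∀ v, (P v).card ≤ s ^ 2 := fun v =>
    (Finset.card_le_card crowd_subset).trans (Finset.card_image_le.trans hR)
  have hcrowd : ∀ i j, i ∉ B → j ∉ B → ident j ∈ (S i).known → u j = u i := by
    intro i j hi hj h3
    rw [hknown i hi, hP, mem_crowd_iff hE hident hj, hpos j hj] at h3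
    exact h3
  refine ⟨fun i => F (u i), u, S, ⟨fun i hi => (key i hi).1, fun i hi => (key i hi).2.1, hdeg,
    ?_, ?_, ?_, ?_, ?_, ?_, ?_, ?_, ?_, ?_, ?_⟩⟩
  · intro i hi p hp
    rw [hslot i hi] at hp
    exact (mem_freeSlots.1 (List.mem_of_getElem? hp)).1
  · intro i hi _
    obtain ⟨h1, -, h3⟩ := hF _ (hdeg i hi)
    rw [hback i hi]
    show (u i, 2) = (pt s (F (u i)) 0 0, L.port (pt s (F (u i)) 0 0) (pt s (F (u i)) 0 1))
    rw [h3, ← h1]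
  · intro i hi h1
    rw [hgroup i hi]
    exact Finset.mem_filter.2 ⟨hmem i hi, hnone i hi h1⟩
  · intro i hi _
    rw [hgroup i hi, hknown i hi]
    exact Finset.filter_subset _ _
  · intro i hi _
    rw [hknown i hi]
    exact crowd_subset
  · intro i hi h1
    have h2 := rank_lt_card (hmem i hi)
    have h3 := hnone i hi h1
    rw [hback i hi, hgroup i hi, hknown i hi, card_filter_rank, chosen, if_pos le_rfl]
    omega
  · intro i j hi hj _ _ e
    rw [hknown i hi, hknown j hj, hgroup i hi, hgroup j hj, hframe i j hi hj e]
    exact ⟨rfl, rfl⟩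
  · intro i j p hi hj hij h1 h2 e
    rw [hslot i hi, e] at h1
    rw [hslot j hj] at h2
    have e' := (List.getElem?_inj (List.getElem?_eq_some_iff.1 h1).1
      (nodup_freeSlots h ∅ ∅)).1 (h1.trans h2.symm)
    exact hij (hident (rank_injOn _ (e ▸ hmem i hi) (hmem j hj) e'))
  · intro i j hi hj _ _ h3
    rw [hcrowd i j hi hj h3]
  · intro i j hi hj _ _ h3
    refine ⟨0, ?_, ?_⟩
    · rw [hback i hi, chosen, if_pos le_rfl]; omega
    · rw [hcrowd i j hi hj h3]
      exact (hF _ (hdeg i hi)).1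
  · intro hpar i j hi hj
    refine ⟨fun h1 => ?_, hodd hpar i j hi hj⟩
    have h2 := rank_lt_card (hmem i hi)
    have h3 := hnone i hi h1
    have h4 := hcard (u i)
    -- For odd `s` the single corner has `s ^ 2` slots, and every rank is smaller.
    rw [hh, slotSide, if_neg (by omega)] at h3
    omega

variable {F : R → Frame} {h τ k q : ℕ} {l : List Instr} {u : R → Fin s × Fin s} {S : R → State}

theorem Arrangement.stage (hs : 2 ≤ s) (hE : E.IsExecution robotAlgorithm L ident B)
    (hident : Function.Injective ident) (hk : k + 1 ≤ 3)
    (A : Arrangement E L ident B F (slotSide s) τ k 2 (stageProgram s ++ l) u S) :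
    ∃ u' S', Arrangement E L ident B F (slotSide s) (τ + (s - 1) + (2 * slotSide s + 2) +
      (2 * slotSide s + 2)) (k + 1) 2 l u' S' := by
  simp only [stageProgram, List.append_assoc] at A
  obtain ⟨u', S', A⟩ := A.advance hs hE
  obtain ⟨S', A⟩ := A.choose hs hE hident hk
  obtain ⟨S', A⟩ := A.choose hs hE hident hk
  exact ⟨u', S', A⟩

/-- After four corners, every robot has a slot. -/
theorem Arrangement.slot_ne_none (hs : 2 ≤ s) (hR : Fintype.card R ≤ s ^ 2)
    (A : Arrangement E L ident B F (slotSide s) τ 3 2 l u S) {i : R} (hi : i ∉ B) :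
    (S i).slot ≠ none := by
  intro hσ
  have h1 := A.count i hi hσ
  have h2 := (Finset.card_le_card (A.known_subset i hi hσ)).trans (Finset.card_image_le.trans hR)
  have h3 := Finset.card_pos.2 ⟨_, A.mem_group i hi hσ⟩
  rw [chosen, if_pos (A.back_bounds hs hi hσ).2] at h1
  have h4 : s ^ 2 ≤ (3 + 1) * slotSide s ^ 2 := by
    have : s ≤ 2 * slotSide s := by unfold slotSide; split <;> omega
    nlinarith
  omega

/-- The second leg of the way from a corner to a slot. -/
theorem step_second (hs : 2 ≤ s) (hL : L.Oriented) (F : Frame) {i j : ℕ} (hi : i < s) (hj : 0 < j)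
    (hj' : j + 1 < s) : L.step false (L.arrive (pt s F i j) (pt s F i (j - 1))) =
      L.arrive (pt s F i (j + 1)) (pt s F i j) := by
  by_cases h0 : i = 0
  · subst h0
    simpa [pt_transpose] using step_side (L := L) hs F.transpose hj hj' false
  · by_cases h1 : i + 1 < s
    · exact step_inner hL F (by omega) h1 hj hj'
    · obtain rfl : i = s - 1 := by omega
      -- In the last row the walk is again along a side, which is the first axis of the rotated
      -- frame.
      have e : ∀ k < s, pt s F.rot k 0 = pt s F (s - 1) k := fun k hk => by
        rw [pt_rot F hk (by omega), Nat.sub_zero]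
      have := step_side (L := L) hs F.rot hj hj' false
      rw [e _ (by omega), e _ (by omega)] at this
      simpa [e _ hj'] using this

/-- The turn on the way from a corner to a slot. -/
theorem step_turn (hs : 2 ≤ s) (F : Frame) {i : ℕ} (hi : 0 < i) (hi' : i < s) :
    L.step true (L.arrive (pt s F i 0) (pt s F (i - 1) 0)) =
      L.arrive (pt s F i 1) (pt s F i 0) := by
  by_cases h1 : i + 1 < s
  · simpa using step_side (L := L) hs F hi h1 true
  · obtain rfl : i = s - 1 := by omega
    have e : ∀ k < s, ∀ k' < s, pt s F.rot k k' = pt s F (s - 1 - k') k := fun k hk k' hk' =>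
      pt_rot F hk hk'
    have := step_corner (L := L) hs F.rot true
    simpa [e 0 (by omega) 0 (by omega), e 0 (by omega) 1 (by omega),
      e 1 (by omega) 0 (by omega)] using this

/-- The positions on the way from the corner of `F` to the slot `p`, with the ports that lead
back. -/
noncomputable def approachPath (L : PortLabeling (grid s)) (F : Frame) (p : ℕ × ℕ) (w : ℕ) :
    (Fin s × Fin s) × ℕ :=
  if w = 0 then (pt s F 0 0, if p.1 = 0 then 1 else 2)
  else if w ≤ p.1 then L.arrive (pt s F w 0) (pt s F (w - 1) 0)
  else L.arrive (pt s F p.1 (w - p.1)) (pt s F p.1 (w - p.1 - 1))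

theorem approachPath_advance (hs : 2 ≤ s) (hL : L.Oriented) {F : Frame}
    (h1 : L.port (pt s F 0 0) (pt s F 1 0) = 1) {p : ℕ × ℕ} (hp : p.1 < s) (hp' : p.2 < s) {w : ℕ}
    (hw : w < p.1 ∨ (p.1 < w ∧ w < p.1 + p.2)) :
    L.step false (approachPath L F p w) = approachPath L F p (w + 1) := by
  rcases hw with hw | ⟨hw, hw'⟩
  · simp only [approachPath]
    rw [if_neg (by omega : ¬ w + 1 = 0), if_pos (by omega : w + 1 ≤ p.1)]
    by_cases h0 : w = 0
    · subst h0
      rw [if_pos rfl, if_neg (by omega)]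
      exact step_corner_of_port hs false (by simpa using h1)
    · rw [if_neg h0, if_pos (by omega)]
      simpa using step_side (L := L) hs F (i := w) (by omega) (by omega) false
  · simp only [approachPath]
    rw [if_neg (by omega : ¬ w + 1 = 0), if_neg (by omega : ¬ w + 1 ≤ p.1), if_neg (by omega),
      if_neg (by omega)]
    have := step_second hs hL F (i := p.1) (j := w - p.1) hp (by omega) (by omega)
    rwa [show w + 1 - p.1 = w - p.1 + 1 by omega]

theorem approachPath_turn (hs : 2 ≤ s) {F : Frame}
    (h2 : L.port (pt s F 0 0) (pt s F 0 1) = 2) {p : ℕ × ℕ} (hp : p.1 < s) :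
    L.step true (approachPath L F p p.1) = approachPath L F p (p.1 + 1) := by
  simp only [approachPath]
  rw [if_neg (by omega : ¬ p.1 + 1 = 0), if_neg (by omega : ¬ p.1 + 1 ≤ p.1)]
  by_cases h0 : p.1 = 0
  -- In row 0 the turn takes place at the corner itself; the fictitious back port 1 sends the robot
  -- out by port 2, along the second axis.
  · rw [h0, if_pos rfl, if_pos rfl]
    have := step_corner_of_port (L := L) (F := F.transpose) (b := 1) hs true
      (by simpa [pt_transpose] using h2)
    simpa [pt_transpose] using this
  · rw [if_neg h0, if_pos le_rfl]
    simpa using step_turn (L := L) hs F (i := p.1) (by omega) hp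

/-- A robot with a slot goes there. -/
theorem ready_approach (hs : 2 ≤ s) (hL : L.Oriented)
    (hE : E.IsExecution robotAlgorithm L ident B) {i : R} (hi : i ∉ B) {F : Frame}
    (h1 : L.port (pt s F 0 0) (pt s F 1 0) = 1) (h2 : L.port (pt s F 0 0) (pt s F 0 1) = 2)
    {p : ℕ × ℕ} (hp : p.1 < s) (hp' : p.2 < s) (w : ℕ) {l : List Instr} {τ : ℕ} {σ : State}
    (h : E.Ready τ i (pt s F 0 0) σ) (hl : σ.todo = (List.range w).map .approach ++ l)
    (hσ : σ.slot = some p) (hb : σ.back = if p.1 = 0 then 1 else 2) :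
    E.Ready (τ + w) i (approachPath L F p (min w (p.1 + p.2))).1
      { σ with todo := l, back := (approachPath L F p (min w (p.1 + p.2))).2 } := by
  have bounds : ∀ w, w ≤ p.1 + p.2 →
      1 ≤ (approachPath L F p w).2 ∧ (approachPath L F p w).2 ≤ 4 := by
    intro w
    induction w with
    | zero => intro _; simp only [approachPath, if_true]; split <;> omega
    | succ w ih =>
      intro hw
      have hb := ih (by omega)
      by_cases hw' : w = p.1
      · rw [hw', ← approachPath_turn hs h2 hp]
        rw [hw'] at hb
        exact step_bounds hs hb.1 hb.2
      · rw [← approachPath_advance hs hL h1 hp hp' (by omega)]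
        exact step_bounds hs hb.1 hb.2
  induction w generalizing l with
  | zero =>
    obtain ⟨⟩ := σ
    simp at hl hb
    subst hl hb
    simpa [approachPath] using h
  | succ w ih =>
    rw [List.range_succ, List.map_append, List.append_assoc] at hl
    have a1 := ih hl
    simp only [List.map_cons, List.map_nil, List.singleton_append] at a1
    by_cases hw : p.1 + p.2 ≤ w
    · rw [show min (w + 1) (p.1 + p.2) = min w (p.1 + p.2) by omega]
      have hm : ∀ d, State.motion { σ with
          todo := .approach w :: l
          back := (approachPath L F p (min w (p.1 + p.2))).2 } d = .stay := by
        intro d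
        simp only [State.motion, hσ]
        rw [if_neg (by omega), if_neg (by omega)]
      have a2 := (a1.stay hE hi (hm _)).2
      simpa [State.update, hm, Motion.isGo, add_assoc] using a2
    · rw [show min w (p.1 + p.2) = w by omega] at a1
      rw [show min (w + 1) (p.1 + p.2) = w + 1 by omega]
      have hbw := bounds w (by omega)
      by_cases hw' : w = p.1
      · have hm : ∀ d, State.motion { σ with
            todo := .approach w :: l
            back := (approachPath L F p w).2 } d =
              .walk true d (approachPath L F p w).2 := by
          intro d
          simp only [State.motion, hσ]
          rw [if_neg (by omega), if_pos (by omega)]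
        have a2 := a1.walk hE hi (two_le_deg hs _) hbw.1 hbw.2 (hm _)
        simp only [Prod.mk.eta] at a2
        have e : L.step true (approachPath L F p w) = approachPath L F p (w + 1) := by
          rw [hw']; exact approachPath_turn hs h2 hp
        rw [e] at a2
        simpa [State.update, hm, Motion.isGo, Motion.walk, add_assoc] using a2
      · have hm : ∀ d, State.motion { σ with
            todo := .approach w :: l
            back := (approachPath L F p w).2 } d =
              .walk false d (approachPath L F p w).2 := by
          intro d
          simp only [State.motion, hσ]
          rw [if_pos (by omega)]
        have a2 := a1.walk hE hi (two_le_deg hs _) hbw.1 hbw.2 (hm _)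
        simp only [Prod.mk.eta] at a2
        rw [approachPath_advance hs hL h1 hp hp' (by omega)] at a2
        simpa [State.update, hm, Motion.isGo, Motion.walk, add_assoc] using a2

theorem approachPath_end {F : Frame} {p : ℕ × ℕ} :
    (approachPath L F p (p.1 + p.2)).1 = pt s F p.1 p.2 := by
  obtain ⟨i, j⟩ := p
  simp only [approachPath]
  split
  · obtain rfl : i = 0 := by omega
    obtain rfl : j = 0 := by omega
    rfl
  · split
    · obtain rfl : j = 0 := by omega
      rfl
    · simp [PortLabeling.arrive]

/-- On an even grid, the slots of different corners are different. -/
theorem corner_eq_of_pt_eq (hpar : s % 2 = 0) {F F' : Frame} {i j i' j' : ℕ} (hi : i < s / 2)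
    (hj : j < s / 2) (hi' : i' < s / 2) (hj' : j' < s / 2) (e : pt s F i j = pt s F' i' j') :
    pt s F 0 0 = pt s F' 0 0 := by
  rw [eq_pt_iff _ _ (by omega) (by omega), pt_fst_val _ (by omega) (by omega),
    pt_snd_val _ (by omega) (by omega)] at e ⊢
  obtain ⟨_ | _, _ | _, _ | _⟩ := F <;> obtain ⟨_ | _, _ | _, _ | _⟩ := F' <;>
    simp [reflect] at e ⊢ <;> omega

/-- The macro round in which the robots terminate. -/
def haltTime (s : ℕ) : ℕ :=
  startTime s + 3 + 3 * ((s - 1) + (2 * slotSide s + 2) + (2 * slotSide s + 2)) + 1 + 2 * s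

theorem slotSide_le (s : ℕ) : slotSide s ≤ s := by unfold slotSide; split <;> omega

theorem haltTime_le {s : ℕ} (hs : 2 ≤ s) : 4 * haltTime s + 1 ≤ 130 * s := by
  have h1 := slotSide_le s
  have h2 : startTime s ≤ 6 * s + 2 := by
    simp only [startTime, gatherProgram]
    split
    · simp; omega
    · simp; omega
  unfold haltTime
  omega

/-- Equal end positions force equal corners: by the disjoint quadrants if `s` is even, by gathering
if `s` is odd. The ports then give equal frames, hence equal slots at one corner, which the
arrangement excludes. -/
theorem dispersed (hs : 2 ≤ s) (hL : L.Oriented) (hE : E.IsExecution robotAlgorithm L ident B)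
    (hident : Function.Injective ident) (hR : Fintype.card R ≤ s ^ 2) {t : ℕ}
    (ht : 4 * haltTime s + 1 ≤ t) : Dispersed B (E.state t) := by
  obtain ⟨F, u, S, A⟩ := exists_arrangement hs hL hE hident hR
  obtain ⟨u, S, A⟩ := A.stage hs hE hident (by omega)
  obtain ⟨u, S, A⟩ := A.stage hs hE hident (by omega)
  obtain ⟨u, S, A⟩ := A.stage hs hE hident (by omega)
  have hle := slotSide_le s
  have key : ∀ i, i ∉ B → ∃ F p, (S i).slot = some p ∧ u i = pt s F 0 0 ∧
      L.port (pt s F 0 0) (pt s F 0 1) = 2 ∧ (E.state t i).pos = pt s F p.1 p.2 ∧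
      (E.state t i).halted = true := by
    intro i hi
    obtain ⟨p, hp⟩ := Option.ne_none_iff_exists'.1 (A.slot_ne_none hs hR hi)
    obtain ⟨G, h1, h2, h3⟩ := exists_corner_frame hs L (A.corner i hi)
    have hlt := A.slot_lt i hi p hp
    have a1 := A.ready i hi
    have htodo := A.todo i hi
    rw [h1] at a1
    have a2 := (a1.stay hE hi (by simp [State.motion, htodo, approachProgram])).2
    have a3 := ready_approach hs hL hE hi h2 h3 (p := p) (by omega) (by omega) (2 * s) a2
      (by simp [State.update, htodo, approachProgram, hp]; rfl)
      (by simp [State.update, htodo, approachProgram, hp])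
      (by simp [State.update, htodo, approachProgram, hp])
    rw [show min (2 * s) (p.1 + p.2) = p.1 + p.2 by omega, approachPath_end] at a3
    have a4 := a3.halt hE hi (by simp [State.motion]) (t := t) (by
      refine le_trans (le_of_eq ?_) ht
      unfold haltTime
      ring)
    exact ⟨G, p, hp, h1, h3, a4.1, a4.2⟩
  refine ⟨fun i hi => ?_, fun i j hi hj hij e => ?_⟩
  · obtain ⟨-, -, -, -, -, -, h⟩ := key i hi
    exact h
  · obtain ⟨G, p, hp, h1, h2, h3, -⟩ := key i hi
    obtain ⟨G', p', hp', h1', h2', h3', -⟩ := key j hj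
    rw [h3, h3'] at e
    have hlt := A.slot_lt i hi p hp
    have hlt' := A.slot_lt j hj p' hp'
    have hu : u i = u j := by
      rcases Nat.mod_two_eq_zero_or_one s with hpar | hpar
      · rw [slotSide, if_pos hpar] at hlt hlt'
        rw [h1, h1']
        exact corner_eq_of_pt_eq hpar hlt.1 hlt.2 hlt'.1 hlt'.2 e
      · exact (A.odd hpar i j hi hj).2
    have hG : G = G' := by
      have h0 : pt s G 0 0 = pt s G' 0 0 := by rw [← h1, ← h1', hu]
      have adj : ∀ G : Frame, (grid s).Adj (pt s G 0 0) (pt s G 0 1) := fun G => by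
        rw [pt_adj_iff] <;> omega
      refine frame_ext hs h0 (L.port_inj (adj G) (h0 ▸ adj G') ?_)
      rw [h2, h0, h2']
    subst hG
    obtain ⟨e1, e2⟩ := pt_inj (by omega) (by omega) (by omega) (by omega) e
    have e3 : p = p' := Prod.ext e1 e2
    subst e3
    exact A.distinct i j p hi hj hij hp hp' hu

end Dispersion

/-! ### The size of the memory -/

section Bounds

variable {D : Finset ℕ} {N t : ℕ}

/-- A table of one number up to `N` for some elements of `D`. -/
structure IsTable (D : Finset ℕ) (N : ℕ) (r : Finset (ℕ × ℕ)) : Prop where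
  fst_mem : ∀ p ∈ r, p.1 ∈ D
  snd_le : ∀ p ∈ r, p.2 ≤ N
  injOn : Set.InjOn Prod.fst (r : Set (ℕ × ℕ))

theorem isTable_empty : IsTable D N ∅ := ⟨by simp, by simp, by simp⟩

theorem IsTable.card_le {r : Finset (ℕ × ℕ)} (h : IsTable D N r) : r.card ≤ D.card :=
  Finset.card_le_card_of_injOn Prod.fst h.fst_mem h.injOn

theorem IsTable.record {r : Finset (ℕ × ℕ)} (h : IsTable D N r) {base P : Finset ℕ} {w : ℕ}
    (hb : base ⊆ D) (hw : w ≤ N) : IsTable D N (record base P w r) := by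
  refine ⟨?_, ?_, ?_⟩
  · rintro ⟨x, k⟩ hp
    rcases mem_record.1 hp with hp | ⟨-, hp, -⟩
    · exact h.fst_mem _ hp
    · exact hb hp
  · rintro ⟨x, k⟩ hp
    rcases mem_record.1 hp with hp | ⟨rfl, -⟩
    · exact h.snd_le _ hp
    · exact hw
  · rintro ⟨x, k⟩ hp ⟨x', k'⟩ hp' hx
    obtain rfl : x = x' := hx
    rcases mem_record.1 hp with h1 | ⟨rfl, -, -, h1⟩ <;>
      rcases mem_record.1 hp' with h2 | ⟨rfl, -, -, h2⟩
    · exact h.injOn h1 h2 rfl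
    · exact absurd h1 (h2 _)
    · exact absurd h2 (h1 _)
    · rfl

def Instr.Bounded (N : ℕ) (a : Instr) : Prop :=
  a.toTriple.1 ≤ N ∧ a.toTriple.2.1 ≤ N ∧ a.toTriple.2.2 ≤ N

theorem bounded_program {s : ℕ} (hN : 2 * s ≤ N) (hN' : 11 ≤ N) : ∀ a ∈ program s, a.Bounded N := by
  have hle := slotSide_le s
  have gather : ∀ a ∈ gatherProgram s, a.Bounded N := by
    intro a ha
    unfold gatherProgram at ha
    split at ha
    · simp at ha
    · simp only [List.mem_append, List.mem_cons, List.mem_replicate] at ha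
      rcases ha with ⟨-, rfl⟩ | rfl | ⟨-, rfl⟩ | rfl | ⟨-, rfl⟩ <;>
        simp only [Instr.Bounded, Instr.toTriple] <;> omega
  have choose : ∀ q ≤ 2, ∀ a ∈ chooseProgram q (slotSide s), a.Bounded N := by
    intro q hq a ha
    simp only [chooseProgram, List.mem_cons, List.mem_append, List.mem_map, List.mem_range,
      List.not_mem_nil, or_false] at ha
    rcases ha with rfl | ⟨w, hw, rfl⟩ | ⟨w, hw, rfl⟩ | rfl <;>
      simp only [Instr.Bounded, Instr.toTriple, Bool.toNat_false, Bool.toNat_true] <;> omega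
  have stage : ∀ a ∈ stageProgram s, a.Bounded N := by
    intro a ha
    simp only [stageProgram, List.mem_append, List.mem_replicate] at ha
    rcases ha with ⟨-, rfl⟩ | ha | ha
    · simp only [Instr.Bounded, Instr.toTriple]; omega
    · exact choose 1 (by omega) a ha
    · exact choose 2 le_rfl a ha
  have approach : ∀ a ∈ approachProgram s, a.Bounded N := by
    intro a ha
    simp only [approachProgram, List.mem_cons, List.mem_append, List.mem_map, List.mem_range,
      List.not_mem_nil, or_false] at ha
    rcases ha with rfl | ⟨w, hw, rfl⟩ | rfl <;>
      simp only [Instr.Bounded, Instr.toTriple] <;> omega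
  intro a ha
  simp only [program, dispersionProgram, List.mem_append, List.mem_cons] at ha
  rcases ha with ha | rfl | rfl | rfl | ha | ha | ha | ha
  · exact gather a ha
  iterate 3 simp only [Instr.Bounded, Instr.toTriple]; omega
  iterate 3 exact stage a ha
  exact approach a ha

theorem length_program_le (s : ℕ) : (program s).length ≤ 20 * s + 19 := by
  have hle := slotSide_le s
  have : (gatherProgram s).length ≤ 3 * s + 2 := by
    unfold gatherProgram
    split
    · simp
    · simp; omega
  simp only [program, dispersionProgram, stageProgram, approachProgram, chooseProgram,
    List.length_append, List.length_cons, List.length_map, List.length_range,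
    List.length_replicate, List.length_nil]
  omega

/-- `D` stands for the set of all identifiers and `N` for a bound on numbers and on program length.
Only the clock and the count are tied to the elapsed time `t`, which allows `N` to stay fixed in the
induction. -/
structure State.Bounded (D : Finset ℕ) (N t : ℕ) (σ : State) : Prop where
  length_todo : σ.todo.length ≤ N
  todo : ∀ a ∈ σ.todo, a.Bounded N
  clock : σ.clock ≤ t
  count : σ.count ≤ t
  back : σ.back ≤ N
  known : σ.known ⊆ D
  group : σ.group ⊆ D
  base : σ.base ⊆ D
  rows : IsTable D N σ.rows
  cols : IsTable D N σ.cols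
  slot : ∀ p, σ.slot = some p → p.1 ≤ N ∧ p.2 ≤ N

theorem State.Bounded.mono {σ : State} (h : σ.Bounded D N t) {t' : ℕ} (ht : t ≤ t') :
    σ.Bounded D N t' :=
  { h with clock := h.clock.trans ht, count := h.count.trans ht }

/-- The only instruction list that grows is the one created after measuring. Its length is linear in
`count + 1`, and a robot can count only as far as time has passed; the factor 100 is generous. -/
theorem State.Bounded.update {σ : State} (h : σ.Bounded D N t) (hN : 100 * (t + 2) ≤ N) (x d : ℕ)
    {e : ℕ} (he : e ≤ 4) {P : Finset ℕ} (hP : P ⊆ D) :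
    (σ.update x d e P).Bounded D N (t + 1) := by
  have hclock := h.clock
  have hcount := h.count
  have base : State.Bounded D N (t + 1) { σ with
      todo := σ.todo.tail
      back := if (σ.motion d).isGo then e else σ.back } :=
    { h.mono (Nat.le_succ t) with
      length_todo := by have := h.length_todo; rw [List.length_tail]; omega
      todo := fun a ha => h.todo a (List.mem_of_mem_tail ha)
      back := by have := h.back; dsimp only; split <;> omega }
  have hhead : ∀ a l, σ.todo = a :: l → a.Bounded N := fun a l hl => h.todo a (by simp [hl])
  unfold State.update
  dsimp only
  split
  · split
    · refine { base with length_todo := ?_, todo := ?_ }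
      · have := length_program_le (σ.count + 1)
        simp only [List.length_append, List.length_replicate]
        omega
      · intro a ha
        rcases List.mem_append.1 ha with ha | ha
        · rw [(List.mem_replicate.1 ha).2]
          simp only [Instr.Bounded, Instr.toTriple]
          omega
        · exact bounded_program (by omega) (by omega) a ha
    · refine { base with clock := ?_, count := ?_ }
      · simpa using hclock
      · dsimp only
        split <;> omega
  next b l hl => exact { base with back := (hhead _ _ hl).2.1 }
  · exact { base with known := hP, group := hP, rows := isTable_empty, cols := isTable_empty }
  · split
    · exact { base with
        base := Finset.sdiff_subset.trans hP, rows := isTable_empty, cols := isTable_empty }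
    · exact base
  next c w l hl =>
    split
    · have hw := (hhead _ _ hl).2.2
      split
      · exact { base with cols := h.cols.record h.base hw }
      · exact { base with rows := h.rows.record h.base hw }
    · exact base
  next q k l hl =>
    split
    · refine { base with known := ?_, group := ?_, slot := ?_ }
      · refine Finset.union_subset h.known fun y hy => ?_
        obtain ⟨p, hp, rfl⟩ := Finset.mem_image.1 hy
        exact h.rows.fst_mem p hp
      · exact (Finset.filter_subset _ _).trans h.group
      · intro p hp
        have hk := (hhead _ _ hl).2.2
        have := (mem_freeSlots.1 (List.mem_of_getElem? hp)).1
        simp only [Instr.toTriple] at hk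
        omega
    · exact base
  · split
    · exact base
    · refine { base with back := ?_ }
      dsimp only
      split <;> omega
  · exact base

structure Memory.Bounded (D : Finset ℕ) (N t : ℕ) (m : Memory) : Prop where
  phase : m.phase ≤ N
  degree : m.degree ≤ N
  port : m.port ≤ N
  state : m.state.Bounded D N t

theorem bounded_initial (hN : 3 ≤ N) : Memory.initial.Bounded D N t := by
  refine ⟨Nat.zero_le _, Nat.zero_le _, Nat.zero_le _, ?_⟩
  constructor <;> simp [Memory.initial, State.initial, isTable_empty, hN]

theorem State.motion_go {σ : State} {d p p' : ℕ} {c : Bool} (h : σ.motion d = .go p p' c) :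
    p' = secondPort d σ.back := by
  unfold State.motion at h
  split at h <;> (try split at h) <;> (try split at h) <;> (try split at h) <;>
    simp_all [Motion.walk]

theorem Memory.Bounded.roundStep {m : Memory} (h : m.Bounded D N t) (hN : 100 * (t + 2) ≤ N) {x : ℕ}
    (hx : x ∈ D) {o : Observation} (hd : o.degree ≤ 4) (he : o.entryPort.getD 0 ≤ 4)
    (ho : o.others.image Prod.fst ⊆ D) : (roundStep x m o).1.Bounded D N (t + 1) := by
  have hs := h.state.mono (Nat.le_succ t)
  have hdeg := h.degree
  have hback := h.state.back
  unfold GridRobots.roundStep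
  dsimp only
  split
  · split <;> exact ⟨by dsimp only; omega, by dsimp only; omega, by simp, hs⟩
  · split
    · exact ⟨by dsimp only; omega, by simp, by simp,
        h.state.update hN x _ (by omega) (Finset.empty_subset _)⟩
    next hm =>
      split
      · exact ⟨by dsimp only; omega, by simp, by simp,
          h.state.update hN x _ he (Finset.empty_subset _)⟩
      · refine ⟨by dsimp only; omega, hdeg, ?_, hs⟩
        dsimp only
        rw [State.motion_go hm]
        unfold secondPort firstPort
        split <;> (try split) <;> (try split) <;> omega
    · exact ⟨by dsimp only; omega, by simp, by simp,
        h.state.update hN x _ (by omega) (Finset.insert_subset hx ho)⟩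
  · exact ⟨by dsimp only; omega, by simp, by simp, hs⟩
  · exact ⟨by dsimp only; omega, hdeg, by simp, hs⟩
  · exact ⟨by simp, by simp, by simp, hs⟩
  · exact ⟨by simp, by simp, by simp,
      h.state.update hN x _ he (Finset.empty_subset _)⟩

/-! ### Lengths of the codes -/

theorem length_pairNatCode_le {κ : ℕ} {p : ℕ × ℕ} (h1 : p.1.size ≤ κ) (h2 : p.2.size ≤ κ) :
    (pairNatCode p).length ≤ 4 * κ + 2 := by
  have h1' := length_natCode_le p.1
  have h2' := length_natCode_le p.2
  simp only [pairNatCode, pairCode, List.length_append]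
  omega

theorem length_tripleCode_le {κ : ℕ} {p : ℕ × ℕ × ℕ} (h1 : p.1.size ≤ κ) (h2 : p.2.1.size ≤ κ)
    (h3 : p.2.2.size ≤ κ) : (pairCode natCode pairNatCode p).length ≤ 6 * κ + 3 := by
  have h1' := length_natCode_le p.1
  have h2' := length_pairNatCode_le h2 h3
  simp only [pairCode, List.length_append]
  omega

theorem length_setCode_le {κ : ℕ} (hD : ∀ x ∈ D, x.size ≤ κ) {S : Finset ℕ} (hS : S ⊆ D) :
    (finsetCode natCode S).length ≤ D.card * (2 * κ + 2) + 1 := by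
  refine (length_finsetCode_le (K := 2 * κ + 1) fun a ha => ?_).trans ?_
  · have := length_natCode_le a
    have := hD a (hS ha)
    omega
  · have := Finset.card_le_card hS
    gcongr

theorem length_tableCode_le {κ : ℕ} (hD : ∀ x ∈ D, x.size ≤ κ) (hN : N.size ≤ κ)
    {r : Finset (ℕ × ℕ)} (hr : IsTable D N r) :
    (finsetCode pairNatCode r).length ≤ D.card * (4 * κ + 3) + 1 := by
  refine (length_finsetCode_le (K := 4 * κ + 2) fun a ha => ?_).trans ?_
  · exact length_pairNatCode_le (hD _ (hr.fst_mem a ha))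
      ((Nat.size_le_size (hr.snd_le a ha)).trans hN)
  · have := hr.card_le
    gcongr

/-- The term `6 * N` comes from the instructions, three numbers each, and `14 * D.card` from three
sets and two tables of pairs, at two bits per binary digit. -/
theorem Memory.Bounded.length_save_le {m : Memory} (h : m.Bounded D N t) {κ : ℕ}
    (hD : ∀ x ∈ D, x.size ≤ κ) (hN : N.size ≤ κ) (ht : t ≤ N) :
    m.save.length ≤ (6 * N + 14 * D.card + 16) * (κ + 1) + 16 := by
  have size : ∀ a ≤ N, a.size ≤ κ := fun a ha => (Nat.size_le_size ha).trans hN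
  have h1 : (pairCode natCode pairNatCode (m.phase, m.degree, m.port)).length ≤ _ :=
    length_tripleCode_le (size _ h.phase) (size _ h.degree) (size _ h.port)
  have h2 :
      (pairCode natCode pairNatCode (m.state.clock, m.state.count, m.state.back)).length ≤ _ :=
    length_tripleCode_le (size _ (h.state.clock.trans ht)) (size _ (h.state.count.trans ht))
      (size _ h.state.back)
  have h3 : (listCode instrCode m.state.todo).length ≤ N * (6 * κ + 4) + 1 := by
    refine (length_listCode_le (K := 6 * κ + 3) fun a ha => ?_).trans ?_
    · have := h.state.todo a ha
      exact length_tripleCode_le (size _ this.1) (size _ this.2.1) (size _ this.2.2)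
    · have := h.state.length_todo
      gcongr
  have h4 := length_setCode_le hD h.state.known
  have h5 := length_setCode_le hD h.state.group
  have h6 := length_setCode_le hD h.state.base
  have h7 := length_tableCode_le hD hN h.state.rows
  have h8 := length_tableCode_le hD hN h.state.cols
  have h9 : (slotCode m.state.slot).length ≤ 4 * κ + 4 := by
    cases hs : m.state.slot with
    | none => simp [slotCode, listCode]
    | some p =>
      have := h.state.slot p hs
      have := length_pairNatCode_le (size _ this.1) (size _ this.2)
      simp [slotCode, listCode]
      omega
  simp only [Memory.save, Memory.toTuple, tupleCode, List.length_cons]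
  unfold pairCode at *
  simp only [List.length_append] at *
  nlinarith

end Bounds

theorem History.IsExecution.state_eq_of_halted {V R : Type} [Fintype R] {G : SimpleGraph V}
    {E : History V R} {A : Algorithm} {L : PortLabeling G} {ident : R → ℕ} {B : Finset R}
    (hE : E.IsExecution A L ident B) {i : R} (hi : i ∉ B)
    {t t' : ℕ} (ht : t ≤ t') (h : (E.state t i).halted = true) : E.state t' i = E.state t i := by
  induction t', ht using Nat.le_induction with
  | base => rfl
  | succ t' _ ih => rw [hE.frozen t' i hi (by rw [ih]; exact h), ih]

section MemorySize

variable {s : ℕ} [NeZero s] {R : Type} [Fintype R] {E : History (Fin s × Fin s) R}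
  {L : PortLabeling (grid s)} {ident : R → ℕ} {B : Finset R}

theorem entryPort_apply_le (q : RobotState (Fin s × Fin s)) (m : List Bool) (a : Action) :
    (q.apply L m a).entryPort.getD 0 ≤ 4 := by
  unfold RobotState.apply
  split
  · simp
  · simp
  · split
    next h => exact ((L.port_mem h.choose_spec.1.symm).2).trans (deg_le_four _)
    · simp

/-- The entry port belongs to the induction because it is stored as the back port. -/
theorem memory_bounded (hE : E.IsExecution robotAlgorithm L ident B) {i : R} (hi : i ∉ B) {N : ℕ}
    (t : ℕ) (hN : 100 * (t + 2) ≤ N) : (E.state t i).entryPort.getD 0 ≤ 4 ∧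
      ((E.state t i).memory = [] ∨ ∃ m : Memory, m.Bounded (Finset.univ.image ident) N t ∧
        (E.state t i).memory = m.save) := by
  induction t with
  | zero =>
    obtain ⟨h1, h2, -⟩ := hE.start i hi
    exact ⟨by simp [h1], Or.inl h2⟩
  | succ t ih =>
    obtain ⟨h1, h2⟩ := ih (by omega)
    by_cases hh : (E.state t i).halted = true
    · rw [hE.frozen t i hi hh]
      exact ⟨h1, h2.imp_right fun ⟨m, hm, e⟩ =>
        ⟨m, { hm with state := hm.state.mono (Nat.le_succ t) }, e⟩⟩
    · rw [hE.step t i hi (by simpa using hh)]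
      refine ⟨entryPort_apply_le _ _ _, Or.inr ?_⟩
      have hm : (Memory.load (E.state t i).memory).Bounded (Finset.univ.image ident) N t := by
        rcases h2 with h2 | ⟨m, hm, h2⟩
        · rw [h2, Memory.load_nil]
          exact bounded_initial (by omega)
        · rw [h2, Memory.load_save]
          exact hm
      refine ⟨_, hm.roundStep (x := ident i) (by omega) (by simp) (deg_le_four _) h1
        (o := E.observe (grid s) ident t i) ?_, ?_⟩
      · intro x hx
        simp only [History.observe, Finset.mem_image, Finset.mem_filter] at hx
        obtain ⟨-, ⟨j, -, rfl⟩, rfl⟩ := hx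
        simp
      · unfold RobotState.apply robotAlgorithm
        dsimp only
        split
        · rfl
        · rfl
        · split <;> rfl

theorem length_memory_le (hs : 2 ≤ s) (hE : E.IsExecution robotAlgorithm L ident B)
    (hR : Fintype.card R ≤ s ^ 2) {c : ℕ}
    (hident : ∀ i, (ident i).size ≤ c * Nat.log 2 (s ^ 2)) {i : R} (hi : i ∉ B)
    (hhalt : (E.state (130 * s) i).halted = true) (t : ℕ) :
    (E.state t i).memory.length ≤ 10 ^ 5 * (c + 20) * (s ^ 2 * Nat.log 2 (s ^ 2)) := by
  -- After termination the memory no longer changes, so the time, and with it `N`, may be taken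
  -- linear in `s`.
  wlog ht : t ≤ 130 * s generalizing t
  · rw [hE.state_eq_of_halted hi (le_of_not_ge ht) hhalt]
    exact this _ le_rfl
  -- `13200 * s` dominates `100 * (130 * s + 2)`.
  rcases (memory_bounded hE hi (N := 13200 * s) t (by omega)).2 with h | ⟨m, hm, h⟩
  · simp [h]
  set n := s ^ 2 with hn
  set ℓ := Nat.log 2 n
  -- The `O(s)` stored instructions are thereby absorbed into the bound `O(n log n)` for the sets
  -- and tables.
  have hsn : 2 * s ≤ n := by nlinarith
  have hℓ : 1 ≤ ℓ := Nat.log_pos (by norm_num) (by omega)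
  have hsize : (13200 * s).size ≤ ℓ + 15 := by
    refine Nat.size_le.2 ?_
    have := Nat.lt_pow_succ_log_self (b := 2) (by norm_num) n
    calc 13200 * s ≤ 2 ^ 14 * n := by omega
      _ < 2 ^ 14 * 2 ^ (ℓ + 1) := by gcongr
      _ = 2 ^ (ℓ + 15) := by ring
  have hcard : (Finset.univ.image ident).card ≤ n := Finset.card_image_le.trans hR
  have := hm.length_save_le (κ := (c + 16) * ℓ)
    (by
      intro x hx
      obtain ⟨j, -, rfl⟩ := Finset.mem_image.1 hx
      exact (hident j).trans (Nat.mul_le_mul_right _ (by omega)))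
    (hsize.trans (by nlinarith)) (by omega)
  rw [h]
  refine this.trans ?_
  calc (6 * (13200 * s) + 14 * (Finset.univ.image ident).card + 16) * ((c + 16) * ℓ + 1) + 16
      ≤ (50000 * n) * ((c + 17) * ℓ) + 16 * (n * ℓ) := by
        gcongr
        · omega
        · nlinarith
        · nlinarith
    _ ≤ _ := by nlinarith [Nat.zero_le (n * ℓ * c)]

end MemorySize

end GridRobots

/-- One algorithm `A` and one constant `T` serve all grids. For identifiers of at most
`c * log n` bits, the memory bound is `M * n * log n` bits, where `M` depends on `c` only.
Here `n = s ^ 2` and `s = √n`. -/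
theorem theorem2 :
    ∃ (A : GridRobots.Algorithm) (T : ℕ), ∀ c : ℕ, ∃ M : ℕ,
      ∀ s : ℕ, 2 ≤ s →
      ∀ L : GridRobots.PortLabeling (GridRobots.grid s), L.Oriented →
      ∀ ident : Fin (s ^ 2) → ℕ, Function.Injective ident →
        (∀ i, Nat.size (ident i) ≤ c * Nat.log 2 (s ^ 2)) →
      ∀ f : ℕ, f ≤ s ^ 2 → ∀ B : Finset (Fin (s ^ 2)), B.card = f →
      ∀ E : GridRobots.History (Fin s × Fin s) (Fin (s ^ 2)), E.IsExecution A L ident B →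
        (∀ t, T * s ≤ t → GridRobots.Dispersed B (E.state t)) ∧
        (∀ t i, i ∉ B → (E.state t i).memory.length ≤ M * (s ^ 2 * Nat.log 2 (s ^ 2))) := by
  refine ⟨GridRobots.robotAlgorithm, 130, fun c => ⟨10 ^ 5 * (c + 20), ?_⟩⟩
  intro s hs L hL ident hident hsize f hf B hB E hE
  have : NeZero s := ⟨by omega⟩
  have hR : Fintype.card (Fin (s ^ 2)) ≤ s ^ 2 := by simp
  have hdisp : ∀ t, 130 * s ≤ t → GridRobots.Dispersed B (E.state t) := fun t ht =>
    GridRobots.dispersed hs hL hE hident hR ((GridRobots.haltTime_le hs).trans ht)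
  exact ⟨hdisp, fun t i hi =>
    GridRobots.length_memory_le hs hE hR hsize hi ((hdisp _ le_rfl).1 i hi) t⟩
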